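/- Graphs are finite and may have loops and multiple edges; a graph is nontrivial if it has at least one edge, and eulerian if it is connected and all its vertex degrees are even. A \emph{circuit} is a closed walk without repeated edges; closed walks are considered up to cyclic shift and reversal. A \emph{circuit decomposition} of $G$ is a collection $\mathcal{C}$ of nontrivial circuits that together use every edge of $G$ exactly once. All embeddings are cellular, in closed surfaces. An \emph{embedding of $G$ relative to $\mathcal{C}$} is an embedding whose collection of facial walks is the (multiset) union of $\mathcal{C}$ and another collection $\mathcal{C}'$ of closed walks; the faces bounded by the elements of $\mathcal{C}'$ are its \emph{outer} faces. $\mathcal{C}$ is \emph{orientably} (\emph{nonorientably}) \emph{realizable} if $G$ has an orientable (nonorientable) embedding relative to $\mathcal{C}$. The \emph{Euler genus} $\gamma$ of an embedding is given by $|V|-|E|+|F| = 2-\gamma$. A \emph{block} is a maximal nonseparable subgraph, where a connected graph is nonseparable if it is not the union of two connected edge-disjoint subgraphs, each with at least one edge, that have exactly one vertex in common (so every loop forms a block by itself). A \emph{tree of cycles} is a connected graph all of whose blocks are cycles (loops and pairs of parallel edges count as cycles). \textbf{Theorem.} Let $\mathcal{C}$ be a circuit decomposition of a nontrivial eulerian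 graph $G$. (a) If $G$ is a tree of cycles and $\mathcal{C}$ is the collection of all cycles of $G$, then every embedding of $G$ relative to $\mathcal{C}$ is planar (that is, in the sphere) and has exactly one outer face, and at least one such embedding exists. (b) Otherwise, $\mathcal{C}$ is both orientably realizable and nonorientably realizable, and there is at least one embedding of $G$ relative to $\mathcal{C}$ that is nonorientable and has exactly one outer face. Moreover, for every embedding of $G$ relative to $\mathcal{C}$ with exactly one outer face, the outer face is bounded by an euler circuit (a circuit containing all edges and vertices of $G$), and the embedding has maximum Euler genus over all embeddings of $G$ relative to $\mathcal{C}$; hence, if it is orientable (nonorientable), it has maximum genus over all orientable (nonorientable) embeddings of $G$ relative to $\mathcal{C}$. -/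

import Mathlib

/-- A graph on a set `V` of vertices and a set `H` of half-edges; loops and multiple edges are
allowed. An edge is an unordered pair `{h, mate h}`. -/
structure HalfEdgeGraph (V : Type*) (H : Type*) where
  /-- the vertex with which a half-edge is incident -/
  inc : H → V
  /-- the other half of the same edge -/
  mate : H → H
  mate_mate : ∀ h, mate (mate h) = h
  mate_ne : ∀ h, mate h ≠ h

namespace HalfEdgeGraph

variable {V H : Type*} (G : HalfEdgeGraph V H)

/-- The edge containing a half-edge. -/
def edge (h : H) : Sym2 H := s(h, G.mate h)

theorem edge_mate (h : H) : G.edge (G.mate h) = G.edge h := by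
  simp [edge, G.mate_mate, Sym2.eq_swap]

/-- The set of edges. -/
def edgeSet : Set (Sym2 H) := Set.range G.edge

/-- The degree of a vertex: the number of half-edges incident with it. -/
noncomputable def degree (v : V) : ℕ := {h : H | G.inc h = v}.ncard

/-! ### Subgraphs, connectedness, blocks -/

/-- A subgraph: a set of vertices and a set of half-edges that consists of whole edges and
contains no edge without its end vertices. -/
@[ext]
structure Subgraph where
  verts : Set V
  halves : Set H
  mate_mem : ∀ h ∈ halves, G.mate h ∈ halves
  inc_mem : ∀ h ∈ halves, G.inc h ∈ verts

namespace Subgraph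

variable {G}

/-- Inclusion of subgraphs. -/
instance : LE G.Subgraph := ⟨fun A B => A.verts ⊆ B.verts ∧ A.halves ⊆ B.halves⟩

/-- A subgraph is connected if it has a vertex and any two of its vertices are joined by a walk
in the subgraph. -/
def Connected (B : G.Subgraph) : Prop :=
  B.verts.Nonempty ∧ ∀ u ∈ B.verts, ∀ v ∈ B.verts,
    Relation.ReflTransGen (fun x y => ∃ h ∈ B.halves, G.inc h = x ∧ G.inc (G.mate h) = y) u v

/-- `A₁`, `A₂` form a separation of `B`: they are connected, each of them has an edge, every edge
of `B` is in exactly one of them, every vertex of `B` is in at least one of them, and they have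
exactly one vertex in common. -/
def IsSeparation (B A₁ A₂ : G.Subgraph) : Prop :=
  A₁.Connected ∧ A₂.Connected ∧ A₁.halves.Nonempty ∧ A₂.halves.Nonempty ∧
    A₁.halves ∪ A₂.halves = B.halves ∧ Disjoint A₁.halves A₂.halves ∧
    A₁.verts ∪ A₂.verts = B.verts ∧ ∃ v, A₁.verts ∩ A₂.verts = {v}

/-- A subgraph is nonseparable if it is connected and has no separation. (So a loop together with
any further edge at its vertex is separable.) -/
def Nonseparable (B : G.Subgraph) : Prop :=
  B.Connected ∧ ¬ ∃ A₁ A₂ : G.Subgraph, B.IsSeparation A₁ A₂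

/-- A block is a maximal nonseparable subgraph. -/
def IsBlock (B : G.Subgraph) : Prop := Maximal Nonseparable B

/-- A subgraph is a cycle if it is connected and `2`-regular. (Loops and digons are cycles.) -/
def IsCycle (B : G.Subgraph) : Prop :=
  B.Connected ∧ ∀ v ∈ B.verts, {h | h ∈ B.halves ∧ G.inc h = v}.ncard = 2

end Subgraph

/-- The graph itself, as a subgraph. -/
def whole : G.Subgraph where
  verts := Set.univ
  halves := Set.univ
  mate_mem _ _ := trivial
  inc_mem _ _ := trivial

/-- A graph is connected if it has a vertex and any two vertices are joined by a walk. -/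
def Connected : Prop := G.whole.Connected

/-- An eulerian graph: connected, and all degrees are even. -/
def IsEulerian : Prop := G.Connected ∧ ∀ v, Even (G.degree v)

/-- A graph is nontrivial if it has an edge. -/
def IsNontrivial : Prop := G.edgeSet.Nonempty

/-- A tree of cycles: a connected graph all of whose blocks are cycles. -/
def IsTreeOfCycles : Prop :=
  G.Connected ∧ ∀ B : G.Subgraph, B.IsBlock → B.IsCycle

/-! ### Closed walks -/

/-- A closed walk of positive length with a direction, up to cyclic shift: the cyclic sequence of
the half-edges along which the walk leaves its successive vertices. The walk traverses the edge of
`g` from `inc g` to `inc (mate g)`. -/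
def DirClosedWalk : Type _ :=
  {c : Cycle H // c ≠ Cycle.nil ∧ c.Chain fun g g' => G.inc (G.mate g) = G.inc g'}

namespace DirClosedWalk

variable {G}

theorem reverse_aux (c : Cycle H)
    (hc : c ≠ Cycle.nil ∧ c.Chain fun g g' => G.inc (G.mate g) = G.inc g') :
    c.reverse.map G.mate ≠ Cycle.nil ∧
      (c.reverse.map G.mate).Chain fun g g' => G.inc (G.mate g) = G.inc g' := by
  induction c using Cycle.induction_on with
  | nil => exact absurd rfl hc.1
  | cons a l _ =>
    refine ⟨by simp [Cycle.reverse_coe], ?_⟩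
    have h2 := (Cycle.chain_coe_cons _ a l).1 hc.2
    rw [Cycle.chain_map, Cycle.reverse_coe, List.reverse_cons]
    have e : ((l.reverse ++ [a] : List H) : Cycle H) = ((a :: l.reverse : List H) : Cycle H) :=
      Cycle.coe_eq_coe.2 (by
        simpa using List.IsRotated.symm (⟨1, by simp⟩ : (a :: l.reverse) ~r (l.reverse ++ [a])))
    rw [e, Cycle.chain_coe_cons]
    have e2 : a :: (l.reverse ++ [a]) = (a :: (l ++ [a])).reverse := by simp
    rw [e2, List.isChain_reverse]
    exact h2.imp fun x y hxy => by simpa [G.mate_mate] using hxy.symm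

/-- The same closed walk, traversed in the opposite direction. -/
def reverse (w : G.DirClosedWalk) : G.DirClosedWalk :=
  ⟨w.1.reverse.map G.mate, reverse_aux w.1 w.2⟩

theorem reverse_reverse (w : G.DirClosedWalk) : w.reverse.reverse = w := by
  obtain ⟨c, hc⟩ := w
  apply Subtype.ext
  change ((c.reverse.map G.mate).reverse.map G.mate) = c
  induction c using Quotient.inductionOn with
  | h l =>
    change ((((l.reverse.map G.mate).reverse).map G.mate : List H) : Cycle H) = (l : Cycle H)
    congr 1
    simp [List.map_reverse, Function.comp_def, G.mate_mate]

/-- The edges used by a closed walk, each as often as it is used. -/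
def edges (w : G.DirClosedWalk) : Multiset (Sym2 H) := w.1.toMultiset.map G.edge

theorem edges_reverse (w : G.DirClosedWalk) : w.reverse.edges = w.edges := by
  obtain ⟨c, hc⟩ := w
  change ((c.reverse.map G.mate).toMultiset.map G.edge) = c.toMultiset.map G.edge
  induction c using Quotient.inductionOn with
  | h l =>
    change (((l.reverse.map G.mate).map G.edge : List (Sym2 H)) : Multiset (Sym2 H)) =
      ((l.map G.edge : List (Sym2 H)) : Multiset (Sym2 H))
    simp [Function.comp_def, G.edge_mate]

/-- Two closed walks are identified if they differ only in direction. -/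
instance setoid : Setoid G.DirClosedWalk where
  r w w' := w' = w ∨ w' = w.reverse
  iseqv :=
    { refl := fun _ => Or.inl rfl
      symm := by
        rintro w w' (rfl | rfl)
        · exact Or.inl rfl
        · exact Or.inr (reverse_reverse _).symm
      trans := by
        rintro w w' w'' (rfl | rfl) (rfl | rfl)
        · exact Or.inl rfl
        · exact Or.inr rfl
        · exact Or.inr rfl
        · exact Or.inl (reverse_reverse _) }

end DirClosedWalk

/-- A closed walk of positive length, up to cyclic shift and direction. -/
def ClosedWalk : Type _ := Quotient (DirClosedWalk.setoid (G := G))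

namespace ClosedWalk

variable {G}

/-- The edges used by a closed walk, each as often as it is used. -/
def edges : G.ClosedWalk → Multiset (Sym2 H) :=
  Quotient.lift DirClosedWalk.edges (by
    rintro w w' (rfl | rfl)
    · rfl
    · exact (DirClosedWalk.edges_reverse _).symm)

/-- A circuit is a closed walk without repeated edges. -/
def IsCircuit (W : G.ClosedWalk) : Prop := W.edges.Nodup

/-- A cycle is a closed walk that uses every edge of a `2`-regular subgraph exactly once. -/
def IsCycle (W : G.ClosedWalk) : Prop :=
  W.IsCircuit ∧ ∀ g, G.edge g ∈ W.edges →
    {h | G.edge h ∈ W.edges ∧ G.inc h = G.inc g}.ncard = 2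

/-- An euler circuit is a circuit that contains all edges and all vertices. -/
def IsEulerCircuit (W : G.ClosedWalk) : Prop :=
  W.IsCircuit ∧ (∀ e ∈ G.edgeSet, e ∈ W.edges) ∧ ∀ v, ∃ h, G.inc h = v ∧ G.edge h ∈ W.edges

end ClosedWalk

open Classical in
/-- A circuit decomposition: a collection of circuits that together use every edge exactly
once. -/
def IsCircuitDecomposition (C : Multiset G.ClosedWalk) : Prop :=
  (∀ W ∈ C, W.IsCircuit) ∧ ∀ e ∈ G.edgeSet, (C.bind ClosedWalk.edges).count e = 1

/-! ### Embeddings -/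

/-- A cellular embedding of a graph in a closed surface, given by a rotation system with edge
signatures. The orbits of `rot` are the sets of half-edges at the vertices, in clockwise order
for a local orientation of the surface at that vertex; `twist` marks the edges of negative
signature, along which the local orientations at the two ends disagree. -/
structure Embedding where
  rot : Equiv.Perm H
  inc_rot : ∀ h, G.inc (rot h) = G.inc h
  sameCycle_rot : ∀ h h', G.inc h = G.inc h' → rot.SameCycle h h'
  twist : H → Bool
  twist_mate : ∀ h, twist (G.mate h) = twist h

namespace Embedding

variable {G} (Φ : G.Embedding)

/-- One step of face tracing. The state `(h, s)` means that the current vertex is left along `h`,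
in clockwise mode if `s` is true and in anticlockwise mode otherwise. The edge of `h` is
traversed, the mode changes if this edge has negative signature, and the walk continues with the
half-edge that follows (clockwise mode) or precedes (anticlockwise mode) the half-edge of
arrival. -/
def step (x : H × Bool) : H × Bool :=
  if xor x.2 (Φ.twist x.1) then (Φ.rot (G.mate x.1), true)
  else (Φ.rot.symm (G.mate x.1), false)

/-- The state in which the same side of the same edge is traversed in the opposite direction. -/
def flip (x : H × Bool) : H × Bool := (G.mate x.1, !xor x.2 (Φ.twist x.1))

theorem flip_flip (x : H × Bool) : Φ.flip (Φ.flip x) = x := by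
  obtain ⟨h, s⟩ := x
  simp only [flip, G.mate_mate, Φ.twist_mate, Prod.mk.injEq, true_and]
  cases s <;> cases Φ.twist h <;> rfl

theorem step_flip_step (x : H × Bool) : Φ.step (Φ.flip (Φ.step x)) = Φ.flip x := by
  obtain ⟨h, s⟩ := x
  cases s <;> cases ht : Φ.twist h <;>
    simp [step, flip, ht, G.mate_mate, Φ.twist_mate]

theorem step_iterate_flip (n : ℕ) (x : H × Bool) :
    Φ.step^[n] (Φ.flip (Φ.step^[n] x)) = Φ.flip x := by
  induction n generalizing x with
  | zero => rfl
  | succ n ih =>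
    rw [Function.iterate_succ_apply, Function.iterate_succ_apply', step_flip_step, ih]

theorem step_injective : Function.Injective Φ.step := fun x y h => by
  have := Φ.step_flip_step x
  rw [h, Φ.step_flip_step] at this
  rw [← Φ.flip_flip x, ← this, Φ.flip_flip]

theorem inc_step (x : H × Bool) : G.inc (Φ.step x).1 = G.inc (G.mate x.1) := by
  unfold step
  split
  · exact Φ.inc_rot _
  · have := Φ.inc_rot (Φ.rot.symm (G.mate x.1))
    simpa using this.symm

theorem minimalPeriod_flip (x : H × Bool) :
    Function.minimalPeriod Φ.step (Φ.flip x) = Function.minimalPeriod Φ.step x := by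
  have key : ∀ y, Function.minimalPeriod Φ.step (Φ.flip y) ∣ Function.minimalPeriod Φ.step y := by
    intro y
    apply Function.IsPeriodicPt.minimalPeriod_dvd
    have h1 := Φ.step_iterate_flip (Function.minimalPeriod Φ.step y) y
    rwa [Function.iterate_minimalPeriod] at h1
  refine Nat.dvd_antisymm (key x) ?_
  have h2 := key (Φ.flip x)
  rwa [Φ.flip_flip] at h2

variable [Finite H]

theorem mem_periodicPts (x : H × Bool) : x ∈ Function.periodicPts Φ.step :=
  Φ.step_injective.mem_periodicPts x

/-- The facial walk traced from a state. -/
noncomputable def tracedWalk (x : H × Bool) : G.DirClosedWalk :=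
  ⟨(Function.periodicOrbit Φ.step x).map Prod.fst, by
    constructor
    · rw [Ne, Cycle.map_eq_nil, Function.periodicOrbit_eq_nil_iff_not_periodic_pt, not_not]
      exact Φ.mem_periodicPts x
    · rw [Cycle.chain_map, Function.periodicOrbit_chain]
      intro n _
      rw [Function.iterate_succ_apply']
      exact (Φ.inc_step _).symm⟩

theorem tracedWalk_step (x : H × Bool) : Φ.tracedWalk (Φ.step x) = Φ.tracedWalk x := by
  apply Subtype.ext
  simp only [tracedWalk, Function.periodicOrbit_apply_eq (Φ.mem_periodicPts x)]

theorem tracedWalk_flip (x : H × Bool) : Φ.tracedWalk (Φ.flip x) = (Φ.tracedWalk x).reverse := by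
  apply Subtype.ext
  change (Function.periodicOrbit Φ.step (Φ.flip x)).map Prod.fst =
    ((Function.periodicOrbit Φ.step x).map Prod.fst).reverse.map G.mate
  have hpos := Function.minimalPeriod_pos_of_mem_periodicPts (Φ.mem_periodicPts x)
  set n := Function.minimalPeriod Φ.step x with hn
  have hx : Φ.step^[n - 1] (Φ.flip (Φ.step^[n - 1] x)) = Φ.flip x := Φ.step_iterate_flip _ _
  have hp : Function.minimalPeriod Φ.step (Φ.flip (Φ.step^[n - 1] x)) = n := by
    rw [Φ.minimalPeriod_flip, Function.minimalPeriod_apply_iterate (Φ.mem_periodicPts x)]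
  rw [← hx, Function.periodicOrbit_apply_iterate_eq (Φ.mem_periodicPts _),
    Function.periodicOrbit_def, Function.periodicOrbit_def, hp, ← hn]
  change ((((List.range n).map _).map Prod.fst : List H) : Cycle H) =
    (((((List.range n).map _).map Prod.fst).reverse.map G.mate : List H) : Cycle H)
  congr 1
  apply List.ext_getElem
  · simp
  · intro i h1 h2
    have hi : i < n := by simpa using h1
    simp only [List.getElem_map, List.getElem_range, List.getElem_reverse, List.length_map,
      List.length_range]
    have e : Φ.step^[n - 1] x = Φ.step^[i] (Φ.step^[n - 1 - i] x) := by
      rw [← Function.iterate_add_apply]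
      congr 2
      omega
    rw [e, Φ.step_iterate_flip]
    rfl

/-- The faces: states are in the same face if they are related by face tracing and by reversal of
the direction of traversal. -/
def Face : Type _ := Quot fun x y : H × Bool => y = Φ.step x ∨ y = Φ.flip x

instance : Finite Φ.Face := inferInstanceAs (Finite (Quot _))

/-- The closed walk that bounds a face. -/
noncomputable def faceWalk : Φ.Face → G.ClosedWalk :=
  Quot.lift (fun x => (Quotient.mk _ (Φ.tracedWalk x) : G.ClosedWalk)) (by
    rintro x y (rfl | rfl)
    · exact congrArg _ (Φ.tracedWalk_step x).symm
    · rw [Φ.tracedWalk_flip]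
      exact Quotient.sound (Or.inr rfl))

/-- The collection of facial walks, one for each face. -/
noncomputable def facialWalks : Multiset G.ClosedWalk :=
  (@Finset.univ Φ.Face (Fintype.ofFinite _)).val.map Φ.faceWalk

/-- The surface is orientable: after reversing the local orientations at a suitable set of
vertices, every edge has positive signature. -/
def Orientable : Prop :=
  ∃ ε : V → Bool, ∀ h, Φ.twist h = xor (ε (G.inc h)) (ε (G.inc (G.mate h)))

/-- The Euler genus `γ` of the surface of an embedding of a connected graph, from Euler's formula
`|V| - |E| + |F| = 2 - γ`. -/
noncomputable def eulerGenus : ℤ :=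
  2 - ((Nat.card V : ℤ) - (G.edgeSet.ncard : ℤ) + (Nat.card Φ.Face : ℤ))

open Classical in
/-- The genus of the surface: half the Euler genus in the orientable case, the Euler genus in the
nonorientable case. -/
noncomputable def genus : ℚ :=
  if Φ.Orientable then (Φ.eulerGenus : ℚ) / 2 else (Φ.eulerGenus : ℚ)

/-- The embedding is planar: the surface is the sphere. -/
def IsPlanar : Prop := Φ.Orientable ∧ Φ.eulerGenus = 0

/-- `Φ` is an embedding relative to `C` with collection `O` of outer faces: the members of `C` and
`O` together are the facial walks of `Φ`. -/
def IsRelative (C O : Multiset G.ClosedWalk) : Prop := Φ.facialWalks = C + O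

end Embedding

/-- `C` is orientably realizable: some orientable embedding is an embedding relative to `C`. -/
def OrientablyRealizable [Finite H] (C : Multiset G.ClosedWalk) : Prop :=
  ∃ (Φ : G.Embedding) (O : Multiset G.ClosedWalk), Φ.IsRelative C O ∧ Φ.Orientable

/-- `C` is nonorientably realizable: some nonorientable embedding is an embedding relative to
`C`. -/
def NonorientablyRealizable [Finite H] (C : Multiset G.ClosedWalk) : Prop :=
  ∃ (Φ : G.Embedding) (O : Multiset G.ClosedWalk), Φ.IsRelative C O ∧ ¬ Φ.Orientable

end HalfEdgeGraph

/-!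
A circuit decomposition `C` amounts to a transition system: an involution `pair` on the half-edges,
without fixed points, that pairs the half-edges at each vertex. Every edge has a face of `C` on one
side and an outer face on the other, so the corners of these two kinds alternate around each vertex.
An embedding relative to `C`, which belongs to the transition system `t`, is therefore the same thing
as a second transition system `t'`, for the outer faces, such that the pairs of `t` and `t'` form a
single cycle at each vertex (`TransitionSystem.Complementary`); see `exists_compatible` and
`Embedding.exists_compatible_of_isRelative`. It is orientable if and only if the edges can be directed
so that all circuits of `t` and `t'` are directed closed walks (`TransitionSystem.Coherent`).
In particular there is at least one outer face, and a single outer face is an euler circuit and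
maximizes the Euler genus, by Euler's formula.

To find `t'`, one starts with `t' = t`, where each pair of `t` is a cycle of its own, and merges two
cycles at a vertex by exchanging the partners in a pair `{a, b}` and a pair `{c, d}` of `t'`: either
`{a, c}, {b, d}` or `{a, d}, {b, c}` will do (`TransitionSystem.exchange`). If one always makes the
choice that agrees with a fixed direction of the circuits of `t`, the result is orientable. For one
outer face, one makes a choice that does not split a circuit of `t'`. Then half-edges on the same
vertex cycle always lie on the same circuit of `t'`, and the process ends with a single circuit, since
the graph is connected. If the two pairs are on the same circuit, such an exchange reverses part of
this circuit, which destroys orientability for good; if they are on different circuits, these are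
joined. So an orientable result means that every exchange joined two circuits, and hence that the
bipartite graph of incidences between vertices and circuits of `t` is acyclic
(`TransitionSystem.MergeState`).

That this incidence graph is acyclic is expressed by the vanishing of its first cohomology
over the field of two elements (`TransitionSystem.TreeLike`), a form that is preserved step by step in the merging
process and that is easy to apply. The coboundary with value `1` on a single pair gives a cut of the
graph at a vertex (`TransitionSystem.TreeLike.exists_cut`). From such cuts, by parity, it follows that
the blocks are the circuits of `t` and that these are all the cycles, and also that every
complementary system has only one circuit. Coherence is a coboundary condition itself. Conversely, in
a tree of cycles the coboundaries are glued together along cut vertices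
(`TransitionSystem.treeLike_of_isTreeOfCycles`). Finally, a cochain on the nodes is determined by its
coboundary and one value, which counts the edges of the incidence graph and shows that the Euler genus
is `0` in this case.
-/

/-! ### Pairs of involutions -/

namespace HalfEdgeGraph

section Involutions

variable {X : Type*} {α β : X → X}

/-- Two points are linked by `α` and `β` if they lie in the same orbit of the group generated by
these involutions. -/
def Linked (α β : X → X) : X → X → Prop := Relation.EqvGen fun x y => y = α x ∨ y = β x

namespace Linked

theorem refl (x : X) : Linked α β x x := Relation.EqvGen.refl x

theorem symm {x y : X} (h : Linked α β x y) : Linked α β y x := Relation.EqvGen.symm _ _ h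

theorem trans {x y z : X} (h : Linked α β x y) (h' : Linked α β y z) : Linked α β x z :=
  Relation.EqvGen.trans _ _ _ h h'

theorem left (x : X) : Linked α β x (α x) := Relation.EqvGen.rel _ _ (Or.inl rfl)

theorem right (x : X) : Linked α β x (β x) := Relation.EqvGen.rel _ _ (Or.inr rfl)

theorem apply_eq {Y : Type*} {f : X → Y} (hα : ∀ x, f (α x) = f x) (hβ : ∀ x, f (β x) = f x)
    {x y : X} (h : Linked α β x y) : f x = f y := by
  induction h with
  | rel x y h => rcases h with rfl | rfl; exacts [(hα x).symm, (hβ x).symm]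
  | refl => rfl
  | symm _ _ _ ih => exact ih.symm
  | trans _ _ _ _ _ ih ih' => exact ih.trans ih'

theorem mono {γ δ : X → X} (hα : ∀ x, Linked γ δ x (α x)) (hβ : ∀ x, Linked γ δ x (β x)) {x y : X}
    (h : Linked α β x y) : Linked γ δ x y := by
  induction h with
  | rel x y h => rcases h with rfl | rfl; exacts [hα x, hβ x]
  | refl => exact refl _
  | symm _ _ _ ih => exact ih.symm
  | trans _ _ _ _ _ ih ih' => exact ih.trans ih'

theorem of_closed (hα : Function.Involutive α) (hβ : Function.Involutive β) {P : X → Prop}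
    (h1 : ∀ x, P x → P (α x)) (h2 : ∀ x, P x → P (β x)) {x y : X} (h : Linked α β x y)
    (hx : P x) : P y := by
  have := apply_eq (f := P) (α := α) (β := β)
    (fun x => propext ⟨fun h => by simpa [hα x] using h1 _ h, h1 x⟩)
    (fun x => propext ⟨fun h => by simpa [hβ x] using h2 _ h, h2 x⟩) h
  exact this ▸ hx

end Linked

theorem linked_iterate (n : ℕ) (x : X) : Linked α β x ((β ∘ α)^[n] x) := by
  induction n with
  | zero => exact .refl x
  | succ n ih =>
    rw [Function.iterate_succ_apply']
    exact (ih.trans (.left _)).trans (.right _)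

/-- Every point of an orbit of `⟨α, β⟩` is, up to an application of `α`, on the forward orbit of
`β ∘ α`. -/
theorem exists_iterate_of_linked [Finite X] (hα : Function.Involutive α)
    (hβ : Function.Involutive β) {x y : X} (h : Linked α β x y) :
    ∃ n, (β ∘ α)^[n] x = y ∨ (β ∘ α)^[n] x = α y := by
  refine h.of_closed hα hβ (P := fun y => ∃ n, (β ∘ α)^[n] x = y ∨ (β ∘ α)^[n] x = α y) ?_ ?_
    ⟨0, Or.inl rfl⟩
  · rintro y ⟨n, h | h⟩
    · exact ⟨n, Or.inr (by rw [h, hα])⟩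
    · exact ⟨n, Or.inl h⟩
  · rintro y ⟨n, h | h⟩
    · have hinj : Function.Injective (β ∘ α) := hβ.injective.comp hα.injective
      obtain ⟨k, hk, hk'⟩ := hinj.mem_periodicPts y
      refine ⟨k - 1 + n, Or.inr (hinj ?_)⟩
      rw [← Function.iterate_succ_apply' (β ∘ α), ← Nat.succ_add, Function.iterate_add_apply, h,
        show (k - 1).succ = k by omega, hk'.eq]
      simp [hα _, hβ _]
    · refine ⟨n + 1, Or.inl ?_⟩
      rw [Function.iterate_succ_apply', h]
      simp [hα _]

/-- A reflection in the dihedral group generated by `α` and `β` fixes a point only if `α` or `β`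
fixes the midpoint of the corresponding path. -/
theorem apply_iterate_ne (hα : Function.Involutive α) (hβ : Function.Involutive β)
    (hne : ∀ x, α x ≠ x) (n : ℕ) (x : X)
    (h : ∀ i < n, β (α ((β ∘ α)^[i] x)) ≠ α ((β ∘ α)^[i] x)) : α ((β ∘ α)^[n] x) ≠ x := by
  induction n using Nat.twoStepInduction generalizing x with
  | zero => exact hne x
  | one =>
    intro e
    refine h 0 one_pos ?_
    have := congrArg α e
    simpa [hα _] using this
  | more n ih _ =>
    intro e
    refine ih (β (α x)) (fun i hi => ?_) ?_
    · have := h (i + 1) (by omega)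
      rwa [Function.iterate_succ_apply] at this
    · have e2 : (β ∘ α)^[n + 2] x = β (α ((β ∘ α)^[n] (β (α x)))) := by
        rw [Function.iterate_succ_apply', Function.iterate_succ_apply]
        rfl
      rw [e2] at e
      have := congrArg (fun z => β (α z)) e
      simpa [hα _, hβ _] using this

theorem iterate_ne_apply (hα : Function.Involutive α) (hβ : Function.Involutive β)
    (hα' : ∀ x, α x ≠ x) (hβ' : ∀ x, β x ≠ x) (n : ℕ) (x : X) : (β ∘ α)^[n] x ≠ α x := fun e =>
  apply_iterate_ne hα hβ hα' n x (fun _ _ => hβ' _) (by rw [e, hα])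

/-- An involution without fixed points changes the sign of some `Bool`-valued function. -/
theorem exists_alternating_one [Finite X] (hα : Function.Involutive α) (hα' : ∀ x, α x ≠ x) :
    ∃ ε : X → Bool, ∀ x, ε (α x) = !ε x := by
  obtain ⟨n, ⟨e⟩⟩ := Finite.exists_equiv_fin X
  refine ⟨fun x => decide (e x < e (α x)), fun x => ?_⟩
  have : e x ≠ e (α x) := fun h => hα' x (e.injective h).symm
  simp only [hα x]
  rcases lt_or_gt_of_ne this with h | h
  · simp [h, h.le]
  · simp [h, h.le]

/-- The orbits of the group generated by two involutions without fixed points are even cycles: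
they have a proper `2`-colouring. -/
theorem exists_alternating [Finite X] (hα : Function.Involutive α) (hβ : Function.Involutive β)
    (hα' : ∀ x, α x ≠ x) (hβ' : ∀ x, β x ≠ x) :
    ∃ ε : X → Bool, ∀ x, ε (α x) = !ε x ∧ ε (β x) = !ε x := by
  let ρ : Equiv.Perm X := hα.toPerm.trans hβ.toPerm
  have hρ : ∀ x, ρ x = β (α x) := fun _ => rfl
  have hρα : ∀ x, ρ (α (ρ x)) = α x := fun x => by simp [hρ, hα _, hβ _]
  have hsame : ∀ x y, ρ.SameCycle x y → ρ.SameCycle (α x) (α y) := by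
    intro x y h
    obtain ⟨n, rfl⟩ := h.exists_nat_pow_eq
    clear h
    induction n with
    | zero => exact .refl _ _
    | succ n ih =>
      refine ih.trans ?_
      rw [pow_succ', Equiv.Perm.mul_apply]
      have := hρα ((ρ ^ n) x)
      exact (this ▸ Equiv.Perm.SameCycle.refl _ _ : ρ.SameCycle _ (ρ _)).trans
        (Equiv.Perm.sameCycle_apply_left.2 (.refl _ _))
  let s := Equiv.Perm.SameCycle.setoid ρ
  let σ : Quotient s → Quotient s := Quotient.map α hsame
  obtain ⟨ε, hε⟩ := exists_alternating_one (α := σ)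
    (fun q => by induction q using Quotient.inductionOn with | h x => simp [σ, hα x])
    (fun q => by
      induction q using Quotient.inductionOn with
      | h x =>
        intro h
        have h' : ρ.SameCycle (α x) x := Quotient.exact h
        obtain ⟨n, hn⟩ := h'.symm.exists_nat_pow_eq
        refine iterate_ne_apply hα hβ hα' hβ' n x ?_
        rw [← hn, Equiv.Perm.coe_pow]
        rfl)
  refine ⟨fun x => ε (Quotient.mk s x), fun x => ⟨hε (Quotient.mk s x), ?_⟩⟩
  have h1 : Quotient.mk s (β x) = Quotient.mk s (α x) := by
    refine Quotient.sound (?_ : ρ.SameCycle _ _)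
    rw [show β x = ρ (α x) by simp [hρ, hα x]]
    exact Equiv.Perm.sameCycle_apply_left.2 (.refl _ _)
  exact (congrArg ε h1).trans (hε (Quotient.mk s x))

/-- If `α` has no fixed points, an orbit of `⟨α, β⟩` that contains a fixed point of `β` is a path
with exactly two ends, the fixed points of `β`; the ends of the path get different colours in
every proper `2`-colouring. -/
theorem exists_other_end [Finite X] (hα : Function.Involutive α) (hβ : Function.Involutive β)
    (hα' : ∀ x, α x ≠ x) {a : X} (ha : β a = a) :
    ∃ e, e ≠ a ∧ β e = e ∧ Linked α β a e ∧ (∀ x, β x = x → Linked α β a x → x = a ∨ x = e) ∧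
      ∀ ε : X → Bool, (∀ x, ε (α x) = !ε x) → (∀ x, β x ≠ x → ε (β x) = !ε x) → ε e = !ε a := by
  classical
  have hex : ∃ n, β (α ((β ∘ α)^[n] a)) = α ((β ∘ α)^[n] a) := by
    obtain ⟨k, hk, hk'⟩ := (hβ.injective.comp hα.injective).mem_periodicPts a
    refine ⟨k - 1, ?_⟩
    have h1 : β (α ((β ∘ α)^[k - 1] a)) = a := by
      have := Function.iterate_succ_apply' (β ∘ α) (k - 1) a
      rw [show (k - 1).succ = k by omega, hk'.eq] at this
      exact this.symm
    have h2 : α ((β ∘ α)^[k - 1] a) = a := by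
      rw [← hβ (α _), h1, ha]
    rw [h1, h2]
  set n := Nat.find hex with hn
  have hmin : ∀ i < n, β (α ((β ∘ α)^[i] a)) ≠ α ((β ∘ α)^[i] a) := fun i hi => Nat.find_min hex hi
  refine ⟨α ((β ∘ α)^[n] a), apply_iterate_ne hα hβ hα' n a hmin, Nat.find_spec hex,
    (linked_iterate n a).trans (.left _), ?_, ?_⟩
  · intro x hx hl
    have hP := hl.of_closed hα hβ (P := fun x => ∃ i ≤ n, x = (β ∘ α)^[i] a ∨ x = α ((β ∘ α)^[i] a))
      ?_ ?_ ⟨0, Nat.zero_le _, Or.inl rfl⟩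
    · obtain ⟨i, hi, rfl | rfl⟩ := hP
      · cases i with
        | zero => exact Or.inl rfl
        | succ i =>
          refine absurd ?_ (hmin i (by omega))
          rw [Function.iterate_succ_apply'] at hx
          simpa [hβ _] using hx.symm
      · rcases hi.lt_or_eq with h | rfl
        · exact absurd hx (hmin i h)
        · exact Or.inr rfl
    · rintro x ⟨i, hi, rfl | rfl⟩
      · exact ⟨i, hi, Or.inr rfl⟩
      · exact ⟨i, hi, Or.inl (hα _)⟩
    · rintro x ⟨i, hi, rfl | rfl⟩
      · cases i with
        | zero => exact ⟨0, hi, Or.inl ha⟩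
        | succ i =>
          refine ⟨i, by omega, Or.inr ?_⟩
          rw [Function.iterate_succ_apply']
          exact hβ _
      · rcases hi.lt_or_eq with h | rfl
        · exact ⟨i + 1, h, Or.inl (Function.iterate_succ_apply' (β ∘ α) i a).symm⟩
        · exact ⟨_, le_rfl, Or.inr (Nat.find_spec hex)⟩
  · intro ε h1 h2
    have : ∀ i ≤ n, ε ((β ∘ α)^[i] a) = ε a := by
      intro i hi
      induction i with
      | zero => rfl
      | succ i ih =>
        rw [Function.iterate_succ_apply', Function.comp_apply, h2 _ (hmin i (by omega)), h1,
          ih (by omega), Bool.not_not]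
    rw [h1, this n le_rfl]

/-- Parity: a finite set that is a union of orbits of an involution `α` without fixed points cannot
be a union of two-element sets and one singleton. -/
theorem not_paired_off_one [Finite X] (hα : Function.Involutive α) (hα' : ∀ x, α x ≠ x) {Y : Set X}
    (hY : ∀ x ∈ Y, α x ∈ Y) {a : X} (ha : a ∈ Y) (σ : X → X)
    (hσ : ∀ x ∈ Y, x ≠ a → σ x ∈ Y ∧ σ x ≠ a ∧ σ x ≠ x ∧ σ (σ x) = x) : False := by
  classical
  have := Fintype.ofFinite X
  have h1 : ∑ x ∈ Y.toFinset, (1 : ZMod 2) = 0 :=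
    Finset.sum_involution (fun x _ => α x) (fun _ _ => by decide) (fun x _ _ => hα' x)
      (fun x hx => by simpa using hY x (by simpa using hx)) (fun x _ => hα x)
  have h2 : ∑ x ∈ Y.toFinset.erase a, (1 : ZMod 2) = 0 := by
    have key : ∀ x ∈ Y.toFinset.erase a, σ x ∈ Y ∧ σ x ≠ a ∧ σ x ≠ x ∧ σ (σ x) = x := fun x hx =>
      hσ x (by simpa using (Finset.mem_erase.1 hx).2) (Finset.mem_erase.1 hx).1
    refine Finset.sum_involution (fun x _ => σ x) (fun _ _ => by decide)
      (fun x hx _ => (key x hx).2.2.1)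
      (fun x hx => by
        have := key x hx
        simp [this.1, this.2.1])
      (fun x hx => (key x hx).2.2.2)
  rw [← Finset.add_sum_erase _ _ (Set.mem_toFinset.2 ha), h2] at h1
  exact absurd h1 (by decide)

/-- A map whose fibres are the pairs `{x, α x}` takes half as many values as there are points. -/
theorem two_mul_ncard_range [Finite X] (hα' : ∀ x, α x ≠ x)
    {Y : Type*} {f : X → Y} (hf : ∀ x y, f x = f y ↔ y = x ∨ y = α x) :
    2 * (Set.range f).ncard = Nat.card X := by
  classical
  have := Fintype.ofFinite X
  have h := Finset.card_eq_sum_card_image f (Finset.univ : Finset X)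
  rw [Finset.sum_congr rfl (g := fun _ => 2), Finset.sum_const, smul_eq_mul] at h
  · rw [Nat.card_eq_fintype_card, ← Finset.card_univ, h, mul_comm]
    congr 1
    rw [← Set.ncard_coe_finset]
    simp
  · intro b hb
    obtain ⟨x, -, rfl⟩ := Finset.mem_image.1 hb
    have : (Finset.univ.filter fun a => f a = f x) = {x, α x} := by
      ext y
      simp only [Finset.mem_filter, Finset.mem_univ, true_and, Finset.mem_insert,
        Finset.mem_singleton]
      rw [eq_comm, hf]
    rw [this, Finset.card_pair (hα' x).symm]

end Involutions

end HalfEdgeGraph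

/-! ### Transition systems -/

namespace HalfEdgeGraph

variable {V H : Type*} {G : HalfEdgeGraph V H}

theorem mate_involutive (G : HalfEdgeGraph V H) : Function.Involutive G.mate := G.mate_mate

/-- A transition system: the half-edges at each vertex are partitioned into pairs. A circuit
decomposition is given by the transition system that pairs the half-edge along which a circuit
arrives at a vertex with the half-edge along which it leaves. -/
@[ext]
structure TransitionSystem (G : HalfEdgeGraph V H) where
  /-- the other half-edge of the same pair -/
  pair : H → H
  pair_pair : Function.Involutive pair
  pair_ne : ∀ h, pair h ≠ h
  inc_pair : ∀ h, G.inc (pair h) = G.inc h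

instance [Finite H] : Finite G.TransitionSystem :=
  Finite.of_injective TransitionSystem.pair fun _ _ => TransitionSystem.ext

namespace TransitionSystem

variable (t t' : G.TransitionSystem)

/-- Half-edges in the same circuit of a transition system. -/
def SameCircuit : H → H → Prop := Linked G.mate t.pair

/-- Two transition systems are complementary if their pairs together form a single cycle on the
half-edges at each vertex. Reading these cycles as rotations, one obtains an embedding in which the
two systems trace the faces on either side of each edge. -/
def Complementary : Prop := ∀ h h', G.inc h = G.inc h' → Linked t.pair t'.pair h h'

/-- Directing the edges so that the circuits of both transition systems are directed closed
walks: `ε` singles out the tail of each edge. -/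
def Coherent : Prop :=
  ∃ ε : H → Bool, ∀ h, ε (G.mate h) = !ε h ∧ ε (t.pair h) = !ε h ∧ ε (t'.pair h) = !ε h

/-- The bipartite graph whose nodes are the vertices and the circuits of `t` and whose edges are the
pairs of `t`, joining a vertex to a circuit, is acyclic. This is expressed by cohomology: every
`Bool`-valued function on the edges is a coboundary. -/
def TreeLike : Prop :=
  ∀ f : H → Bool, (∀ h, f (t.pair h) = f h) → ∃ (φ : V → Bool) (ψ : H → Bool),
    (∀ h, ψ (G.mate h) = ψ h ∧ ψ (t.pair h) = ψ h) ∧ ∀ h, f h = xor (φ (G.inc h)) (ψ h)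

variable {t t'}

/-! ### Merging transitions -/

section Merge

open Classical in
/-- The pairs `{a, pair a}` and `{c, pair c}` at the same vertex are replaced by `{a, c}` and
`{pair a, pair c}`. -/
noncomputable def exchange (t' : G.TransitionSystem) (a c : H) (hac : G.inc a = G.inc c) :
    G.TransitionSystem where
  pair h := Equiv.swap (t'.pair a) c (t'.pair (Equiv.swap (t'.pair a) c h))
  pair_pair h := by simp [t'.pair_pair _]
  pair_ne h e := t'.pair_ne (Equiv.swap (t'.pair a) c h)
    ((Equiv.swap (t'.pair a) c).injective (by simpa using e))
  inc_pair h := by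
    have key : ∀ x, G.inc (Equiv.swap (t'.pair a) c x) = G.inc x := by
      intro x
      by_cases h1 : x = t'.pair a
      · rw [h1, Equiv.swap_apply_left, t'.inc_pair, hac]
      · by_cases h2 : x = c
        · rw [h2, Equiv.swap_apply_right, t'.inc_pair, hac]
        · rw [Equiv.swap_apply_of_ne_of_ne h1 h2]
    rw [key, t'.inc_pair, key]

variable {a c : H} (hac : G.inc a = G.inc c)

theorem exchange_apply_a (h1 : c ≠ a) : (t'.exchange a c hac).pair a = c := by
  classical
  simp only [exchange]
  rw [Equiv.swap_apply_of_ne_of_ne (t'.pair_ne a).symm h1.symm, Equiv.swap_apply_left]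

theorem exchange_apply_pair_a (h1 : c ≠ a) :
    (t'.exchange a c hac).pair (t'.pair a) = t'.pair c := by
  classical
  simp only [exchange]
  rw [Equiv.swap_apply_left, Equiv.swap_apply_of_ne_of_ne _ (t'.pair_ne c)]
  exact fun h => h1 (t'.pair_pair.injective h)

theorem exchange_apply_of_ne {x : H} (ha : x ≠ a) (ha' : x ≠ t'.pair a) (hc : x ≠ c)
    (hc' : x ≠ t'.pair c) : (t'.exchange a c hac).pair x = t'.pair x := by
  classical
  simp only [exchange]
  rw [Equiv.swap_apply_of_ne_of_ne ha' hc, Equiv.swap_apply_of_ne_of_ne]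
  · exact fun h => ha (t'.pair_pair.injective h)
  · exact fun h => hc' (by rw [← h, t'.pair_pair])

open Classical in
/-- The pairing of `t'` with the pairs `{a, pair a}` and `{c, pair c}` cut open. -/
noncomputable def cutPair (t' : G.TransitionSystem) (a c x : H) : H :=
  if x = a ∨ x = t'.pair a ∨ x = c ∨ x = t'.pair c then x else t'.pair x

theorem cutPair_of_ne {x : H} (ha : x ≠ a) (ha' : x ≠ t'.pair a) (hc : x ≠ c)
    (hc' : x ≠ t'.pair c) : t'.cutPair a c x = t'.pair x := by
  simp [cutPair, *]

theorem cutPair_eq_self {x : H} :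
    t'.cutPair a c x = x ↔ x = a ∨ x = t'.pair a ∨ x = c ∨ x = t'.pair c := by
  unfold cutPair
  split_ifs with h
  · simpa using h
  · simpa [t'.pair_ne] using h

theorem cutPair_involutive : Function.Involutive (t'.cutPair a c) := by
  intro x
  by_cases h : x = a ∨ x = t'.pair a ∨ x = c ∨ x = t'.pair c
  · rw [cutPair_eq_self.2 h, cutPair_eq_self.2 h]
  · have hx : t'.cutPair a c x = t'.pair x := by simp [cutPair, h]
    have key : ∀ y, t'.pair x = y ↔ x = t'.pair y := fun y =>
      ⟨fun e => by rw [← e, t'.pair_pair], fun e => by rw [e, t'.pair_pair]⟩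
    have : ¬ (t'.pair x = a ∨ t'.pair x = t'.pair a ∨ t'.pair x = c ∨ t'.pair x = t'.pair c) := by
      simp only [key, t'.pair_pair _]
      tauto
    rw [hx]
    simp [cutPair, this, t'.pair_pair x]

variable {α : H → H}

theorem linked_of_cut {x y : H} (h : Linked α (t'.cutPair a c) x y) : Linked α t'.pair x y := by
  refine h.mono .left fun x => ?_
  unfold cutPair
  split_ifs
  exacts [.refl _, .right _]

theorem linked_exchange_of_cut {x y : H} (h : Linked α (t'.cutPair a c) x y) :
    Linked α (t'.exchange a c hac).pair x y := by
  refine h.mono .left fun x => ?_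
  by_cases h : x = a ∨ x = t'.pair a ∨ x = c ∨ x = t'.pair c
  · rw [cutPair_eq_self.2 h]
    exact .refl _
  · push Not at h
    rw [cutPair_of_ne h.1 h.2.1 h.2.2.1 h.2.2.2,
      ← exchange_apply_of_ne hac h.1 h.2.1 h.2.2.1 h.2.2.2]
    exact .right _

theorem cutPair_swap (t' : G.TransitionSystem) (a c : H) :
    t'.cutPair a c = t'.cutPair c a := by
  funext x
  simp only [cutPair]
  congr 1
  exact propext (by tauto)

theorem cutPair_pair (t' : G.TransitionSystem) (a c : H) :
    t'.cutPair a (t'.pair c) = t'.cutPair a c := by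
  funext x
  simp only [cutPair]
  congr 1
  rw [t'.pair_pair c]
  exact propext (or_congr_right (or_congr_right or_comm))

/-- Cutting two pairs open leaves a path that starts at `a` and ends at one of the other three
loose half-edges. -/
theorem exists_end_of_cut [Finite H] (hα : Function.Involutive α) (hα' : ∀ x, α x ≠ x)
    (t' : G.TransitionSystem) (a c : H) :
    ∃ e, (e = t'.pair a ∨ e = c ∨ e = t'.pair c) ∧ Linked α (t'.cutPair a c) a e ∧
      (∀ x, (x = t'.pair a ∨ x = c ∨ x = t'.pair c) → Linked α (t'.cutPair a c) a x →
        x = a ∨ x = e) ∧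
      ∀ ε : H → Bool, (∀ x, ε (α x) = !ε x) →
        (∀ x, x ≠ a → x ≠ t'.pair a → x ≠ c → x ≠ t'.pair c → ε (t'.pair x) = !ε x) →
        ε e = !ε a := by
  obtain ⟨e, hne, he, hl, huniq, hcol⟩ := exists_other_end hα (cutPair_involutive (t' := t')) hα'
    (cutPair_eq_self.2 (Or.inl rfl) : t'.cutPair a c a = a)
  refine ⟨e, (cutPair_eq_self.1 he).resolve_left hne, hl,
    fun x hx => huniq x (cutPair_eq_self.2 (Or.inr hx)), fun ε h1 h2 => hcol ε h1 fun x hx => ?_⟩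
  have := mt cutPair_eq_self.2 hx
  push Not at this
  rw [cutPair_of_ne this.1 this.2.1 this.2.2.1 this.2.2.2]
  exact h2 x this.1 this.2.1 this.2.2.1 this.2.2.2

/-- After the exchange everything that was linked is still linked, provided that `a` and `pair a`
are, and `c` and `pair c` are. -/
theorem linked_exchange (ha : Linked α (t'.exchange a c hac).pair a (t'.pair a))
    (hc : Linked α (t'.exchange a c hac).pair c (t'.pair c)) {x y : H}
    (h : Linked α t'.pair x y) : Linked α (t'.exchange a c hac).pair x y := by
  refine h.mono .left fun x => ?_
  by_cases h1 : x = a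
  · rw [h1]; exact ha
  by_cases h2 : x = t'.pair a
  · rw [h2, t'.pair_pair]; exact ha.symm
  by_cases h3 : x = c
  · rw [h3]; exact hc
  by_cases h4 : x = t'.pair c
  · rw [h4, t'.pair_pair]; exact hc.symm
  rw [← exchange_apply_of_ne hac h1 h2 h3 h4]
  exact .right _

/-- If `a` and `c` are on different cycles at their vertex, cutting open the pairs `{a, pair a}` and
`{c, pair c}` turns the first cycle into a path from `a` to `pair a`, with ends of different
colours. -/
theorem cut_linked_left [Finite H] (hS : ¬ Linked t.pair t'.pair a c) :
     Linked t.pair (t'.cutPair a c) a (t'.pair a) ∧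
    ∀ ε : H → Bool, (∀ x, ε (t.pair x) = !ε x) →
        (∀ x, x ≠ a → x ≠ t'.pair a → x ≠ c → x ≠ t'.pair c → ε (t'.pair x) = !ε x) →
        ε (t'.pair a) = !ε a := by
  obtain ⟨e, he, hl, -, hcol⟩ := exists_end_of_cut t.pair_pair t.pair_ne t' a c
  have : e = t'.pair a := by
    rcases he with rfl | rfl | rfl
    · rfl
    · exact absurd (linked_of_cut hl) hS
    · exact absurd ((linked_of_cut hl).trans (Linked.right (β := t'.pair) c).symm) hS
  exact ⟨this ▸ hl, fun ε h1 h2 => this ▸ hcol ε h1 h2⟩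

theorem cut_linked_right [Finite H] (hS : ¬ Linked t.pair t'.pair a c) :
     Linked t.pair (t'.cutPair a c) c (t'.pair c) ∧
    ∀ ε : H → Bool, (∀ x, ε (t.pair x) = !ε x) →
        (∀ x, x ≠ a → x ≠ t'.pair a → x ≠ c → x ≠ t'.pair c → ε (t'.pair x) = !ε x) →
        ε (t'.pair c) = !ε c := by
  have := cut_linked_left (fun h => hS h.symm : ¬ Linked t.pair t'.pair c a)
  rw [cutPair_swap] at this
  exact ⟨this.1, fun ε h h' => this.2 ε h fun x h1 h2 h3 h4 => h' x h3 h4 h1 h2⟩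

theorem linked_vertex_exchange [Finite H] (hS : ¬ Linked t.pair t'.pair a c) {x y : H}
    (h : Linked t.pair t'.pair x y) :
    Linked t.pair (t'.exchange a c hac).pair x y :=
  linked_exchange hac (linked_exchange_of_cut hac (cut_linked_left hS).1)
    (linked_exchange_of_cut hac (cut_linked_right hS).1) h

theorem linked_vertex_exchange_new (hS : ¬ Linked t.pair t'.pair a c) :
    Linked t.pair (t'.exchange a c hac).pair a c := by
  have h1 : c ≠ a := fun h => hS (h ▸ .refl _)
  have := Linked.right (α := t.pair) (β := (t'.exchange a c hac).pair) a
  rwa [exchange_apply_a hac h1] at this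

/-- The exchange does not create orientability. -/
theorem alternating_of_exchange [Finite H] (hS : ¬ Linked t.pair t'.pair a c) {ε : H → Bool}
    (h1 : ∀ x, ε (t.pair x) = !ε x)
    (h2 : ∀ x, ε ((t'.exchange a c hac).pair x) = !ε x) (x : H) : ε (t'.pair x) = !ε x := by
  have h3 : ∀ x, x ≠ a → x ≠ t'.pair a → x ≠ c → x ≠ t'.pair c → ε (t'.pair x) = !ε x :=
    fun x ha ha' hc hc' => by rw [← exchange_apply_of_ne hac ha ha' hc hc', h2]
  have ha := (cut_linked_left hS).2 ε h1 h3
  have hc := (cut_linked_right hS).2 ε h1 h3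
  by_cases e1 : x = a
  · rw [e1, ha]
  by_cases e2 : x = t'.pair a
  · rw [e2, ha, t'.pair_pair, Bool.not_not]
  by_cases e3 : x = c
  · rw [e3, hc]
  by_cases e4 : x = t'.pair c
  · rw [e4, hc, t'.pair_pair, Bool.not_not]
  exact h3 x e1 e2 e3 e4

end Merge

end TransitionSystem

end HalfEdgeGraph

/-! ### Complementary transition systems -/

namespace HalfEdgeGraph
variable {V H : Type*} {G : HalfEdgeGraph V H}

namespace TransitionSystem

variable {t t' : G.TransitionSystem}

/-- A property of transition systems that can be preserved while two vertex cycles are merged, and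
that `t` has, is shared by some transition system complementary to `t`. -/
theorem exists_complementary [Finite H] (t : G.TransitionSystem) (I : G.TransitionSystem → Prop)
    (h0 : I t)
    (hstep : ∀ (t' : G.TransitionSystem) (a c : H), G.inc a = G.inc c → I t' →
      ¬ Linked t.pair t'.pair a c →
        ∃ (d : H) (hd : G.inc a = G.inc d), ¬ Linked t.pair t'.pair a d ∧ I (t'.exchange a d hd)) :
    ∃ t' : G.TransitionSystem, I t' ∧ t.Complementary t' := by
  have : Nonempty {t' : G.TransitionSystem // I t'} := ⟨⟨t, h0⟩⟩
  obtain ⟨⟨t', ht'⟩, hmax⟩ := Finite.exists_max fun t' : {t' : G.TransitionSystem // I t'} =>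
    {p : H × H | Linked t.pair t'.1.pair p.1 p.2}.ncard
  refine ⟨t', ht', fun a c hac => ?_⟩
  by_contra hS
  obtain ⟨d, hd, hS', hI⟩ := hstep t' a c hac ht' hS
  refine (hmax ⟨_, hI⟩).not_gt (Set.ncard_lt_ncard ?_)
  refine ⟨fun p hp => linked_vertex_exchange hd hS' hp, fun hsub => hS' ?_⟩
  exact hsub (show (a, d) ∈ {p : H × H | Linked t.pair (t'.exchange a d hd).pair p.1 p.2} from
    linked_vertex_exchange_new hd hS')

theorem not_linked_pair {a c : H} (hS : ¬ Linked t.pair t'.pair a c) :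
    ¬ Linked t.pair t'.pair a (t'.pair c) := fun h => hS (h.trans (Linked.right c).symm)

/-- A complementary transition system can be chosen compatibly with any direction of the circuits
of `t`. -/
theorem exists_complementary_coherent [Finite H] (t : G.TransitionSystem) :
    ∃ t' : G.TransitionSystem, t.Coherent t' ∧ t.Complementary t' := by
  obtain ⟨ε, hε⟩ := exists_alternating G.mate_involutive t.pair_pair G.mate_ne t.pair_ne
  obtain ⟨t', h, h'⟩ := t.exists_complementary (fun t' => ∀ h, ε (t'.pair h) = !ε h)
    (fun h => (hε h).2) (by
      intro t' a c hac hI hS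
      obtain ⟨d, hd, hS', had⟩ : ∃ (d : H), G.inc a = G.inc d ∧ ¬ Linked t.pair t'.pair a d ∧
          ε d = !ε a := by
        by_cases h : ε c = ε a
        · exact ⟨t'.pair c, by rw [t'.inc_pair, hac], not_linked_pair hS, by rw [hI, h]⟩
        · exact ⟨c, hac, hS, by simpa using Bool.eq_not_of_ne h⟩
      have h1 : d ≠ a := fun h => hS' (h ▸ .refl _)
      refine ⟨d, hd, hS', fun x => ?_⟩
      have e1 := exchange_apply_a (t' := t') hd h1
      have e2 := exchange_apply_pair_a (t' := t') hd h1
      have e3 := (congrArg _ e1).symm.trans ((t'.exchange a d hd).pair_pair a)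
      have e4 := (congrArg _ e2).symm.trans ((t'.exchange a d hd).pair_pair _)
      by_cases x1 : x = a
      · rw [x1, e1, had]
      by_cases x2 : x = t'.pair a
      · rw [x2, e2, hI, hI, had]
      by_cases x3 : x = d
      · rw [x3, e3, had, Bool.not_not]
      by_cases x4 : x = t'.pair d
      · rw [x4, e4, hI, hI, had, Bool.not_not]
      rw [exchange_apply_of_ne hd x1 x2 x3 x4, hI])
  exact ⟨t', ⟨ε, fun h1 => ⟨(hε h1).1, (hε h1).2, h h1⟩⟩, h'⟩

/-- The invariant of the merging process that leads to a single outer face: half-edges on the same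
vertex cycle are always on the same circuit of `t'`, and as long as the surface is orientable, the
incidence graph of the vertex cycles and the circuits of `t` is acyclic. -/
structure MergeState (t t' : G.TransitionSystem) : Prop where
  sameCircuit : ∀ h, t'.SameCircuit h (t.pair h)
  treeLike : t.Coherent t' → ∀ f : H → Bool, (∀ h, f (t.pair h) = f h) →
    ∃ φ ψ : H → Bool, (∀ h, φ (t.pair h) = φ h ∧ φ (t'.pair h) = φ h) ∧
      (∀ h, ψ (G.mate h) = ψ h ∧ ψ (t.pair h) = ψ h) ∧ ∀ h, f h = xor (φ h) (ψ h)

theorem mergeState_self (t : G.TransitionSystem) : t.MergeState t where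
  sameCircuit := .right
  treeLike _ f hf := ⟨f, fun _ => false, fun h => ⟨hf h, hf h⟩, fun _ => ⟨rfl, rfl⟩, by simp⟩

section

variable [Finite H] {a c d : H}

/-- An exchange preserves the invariant if it does not split a circuit of `t'` and either destroys
orientability or joins two circuits. -/
theorem MergeState.exchange (hM : t.MergeState t') (hac : G.inc a = G.inc c)
    (hS : ¬ Linked t.pair t'.pair a c)
    (hRa : (t'.exchange a c hac).SameCircuit a (t'.pair a))
    (hRc : (t'.exchange a c hac).SameCircuit c (t'.pair c))
    (hR : t.Coherent (t'.exchange a c hac) → ¬ t'.SameCircuit a c) :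
    t.MergeState (t'.exchange a c hac) where
  sameCircuit h := linked_exchange hac hRa hRc (hM.sameCircuit h)
  treeLike := by
    classical
    intro hcoh f hf
    have hR' := hR hcoh
    obtain ⟨ε, hε⟩ := hcoh
    obtain ⟨φ, ψ, hφ, hψ, hfe⟩ := hM.treeLike ⟨ε, fun h => ⟨(hε h).1, (hε h).2.1,
      alternating_of_exchange hac hS (fun x => (hε x).2.1) (fun x => (hε x).2.2) h⟩⟩ f hf
    -- The circuits of `t'` through `a` and `c` are distinct, so that adding a constant on the one
    -- through `a`, to both functions, makes `φ` constant on the merged vertex cycle.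
    let χ : H → Bool := fun x => xor (φ a) (φ c) && decide (t'.SameCircuit a x)
    have hχ : ∀ {x y}, t'.SameCircuit x y → χ y = χ x := fun {x y} h => by
      simp only [χ]
      congr 2
      exact propext ⟨fun h' => h'.trans h.symm, fun h' => h'.trans h⟩
    have hφ2 : ∀ h, xor (φ (t'.pair h)) (χ (t'.pair h)) = xor (φ h) (χ h) := fun h => by
      rw [(hφ h).2, hχ (.right h)]
    have hχa : χ a = xor (φ a) (φ c) := by
      have : t'.SameCircuit a a := .refl a
      simp [χ, this]
    have hχc : χ c = false := by simp [χ, hR']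
    have hφac : xor (φ c) (χ c) = xor (φ a) (χ a) := by rw [hχa, hχc]; simp
    refine ⟨fun x => xor (φ x) (χ x), fun x => xor (ψ x) (χ x), fun h => ⟨?_, ?_⟩,
      fun h => ⟨?_, ?_⟩, fun h => ?_⟩
    · simp only [(hφ h).1, hχ (hM.sameCircuit h)]
    · have h1 : c ≠ a := fun h => hS (h ▸ .refl _)
      have e1 := exchange_apply_a (t' := t') hac h1
      have e2 := exchange_apply_pair_a (t' := t') hac h1
      have e3 := (congrArg _ e1).symm.trans ((t'.exchange a c hac).pair_pair a)
      have e4 := (congrArg _ e2).symm.trans ((t'.exchange a c hac).pair_pair _)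
      by_cases x1 : h = a
      · simp only [x1, e1, hφac]
      by_cases x2 : h = t'.pair a
      · simp only [x2, e2, hφ2, hφac]
      by_cases x3 : h = c
      · simp only [x3, e3, hφac]
      by_cases x4 : h = t'.pair c
      · simp only [x4, e4, hφ2, hφac]
      rw [exchange_apply_of_ne hac x1 x2 x3 x4]
      exact hφ2 h
    · simp only [(hψ h).1, hχ (.left h)]
    · simp only [(hψ h).2, hχ (hM.sameCircuit h)]
    · rw [hfe]
      change _ = xor (xor (φ h) (χ h)) (xor (ψ h) (χ h))
      cases φ h <;> cases ψ h <;> cases χ h <;> rfl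

/-- If the path from `a` ends at `pair d`, joining `a` to `d` does not split a circuit, and
reverses part of it; the result is not orientable. -/
theorem MergeState.exchange_of_path (hM : t.MergeState t') (had : G.inc a = G.inc d)
    (hS : ¬ Linked t.pair t'.pair a d) (hl : Linked G.mate (t'.cutPair a d) a (t'.pair d))
    (hcol : ∀ ε : H → Bool, (∀ x, ε (G.mate x) = !ε x) →
      (∀ x, x ≠ a → x ≠ t'.pair a → x ≠ d → x ≠ t'.pair d → ε (t'.pair x) = !ε x) →
        ε (t'.pair d) = !ε a) :
    t.MergeState (t'.exchange a d had) := by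
  have h1 : d ≠ a := fun h => hS (h ▸ .refl _)
  have e1 := exchange_apply_a (t' := t') had h1
  have e2 := exchange_apply_pair_a (t' := t') had h1
  have l0 : (t'.exchange a d had).SameCircuit a (t'.pair d) := linked_exchange_of_cut had hl
  have l1 : (t'.exchange a d had).SameCircuit a d := by
    have := Linked.right (α := G.mate) (β := (t'.exchange a d had).pair) a
    rwa [e1] at this
  have l2 : (t'.exchange a d had).SameCircuit (t'.pair a) (t'.pair d) := by
    have := Linked.right (α := G.mate) (β := (t'.exchange a d had).pair) (t'.pair a)
    rwa [e2] at this
  refine hM.exchange had hS (l0.trans l2.symm) (l1.symm.trans l0) ?_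
  rintro ⟨ε, hε⟩
  have c1 := alternating_of_exchange had hS (fun x => (hε x).2.1) (fun x => (hε x).2.2)
  have c2 := hcol ε (fun x => (hε x).1) (fun x _ _ _ _ => c1 x)
  have c3 := (hε (t'.pair a)).2.2
  rw [e2, c1 a, c2] at c3
  exact absurd c3 (by cases ε a <;> simp)

/-- Of the two exchanges that merge two vertex cycles, at least one preserves the invariant. -/
theorem MergeState.exists_exchange (hM : t.MergeState t') (hac : G.inc a = G.inc c)
    (hS : ¬ Linked t.pair t'.pair a c) :
    ∃ (d : H) (hd : G.inc a = G.inc d), ¬ Linked t.pair t'.pair a d ∧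
      t.MergeState (t'.exchange a d hd) := by
  have h1 : c ≠ a := fun h => hS (h ▸ .refl _)
  have h2 : c ≠ t'.pair a := fun h => hS (h ▸ .right _)
  have h3 : t'.pair c ≠ a := fun h => h2 (by rw [← h, t'.pair_pair])
  have h4 : t'.pair c ≠ t'.pair a := fun h => h1 (t'.pair_pair.injective h)
  obtain ⟨e, he, hl, huniq, hcol⟩ := exists_end_of_cut G.mate_involutive G.mate_ne t' a c
  rcases he with he | he | he <;> rw [he] at hl huniq hcol
  · -- The two pairs belong to different circuits.
    have hnc : ¬ Linked G.mate (t'.cutPair a c) a c := fun h =>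
      (huniq c (Or.inr (Or.inl rfl)) h).elim h1 h2
    have hnd : ¬ Linked G.mate (t'.cutPair a c) a (t'.pair c) := fun h =>
      (huniq _ (Or.inr (Or.inr rfl)) h).elim h3 h4
    have hlc : Linked G.mate (t'.cutPair a c) c (t'.pair c) := by
      obtain ⟨e, he, hl', -, -⟩ := exists_end_of_cut G.mate_involutive G.mate_ne t' c a
      rw [cutPair_swap] at hl'
      rcases he with rfl | rfl | rfl
      · exact hl'
      · exact absurd hl'.symm hnc
      · exact absurd (hl.trans hl'.symm) hnc
    refine ⟨c, hac, hS, hM.exchange hac hS (linked_exchange_of_cut hac hl)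
      (linked_exchange_of_cut hac hlc) fun _ hR => hnc ?_⟩
    refine hR.of_closed G.mate_involutive t'.pair_pair
      (P := fun x => Linked G.mate (t'.cutPair a c) a x) (fun x hx => hx.trans (.left x))
      (fun x hx => ?_) (.refl a)
    by_cases x1 : x = a
    · rw [x1]; exact hl
    by_cases x2 : x = t'.pair a
    · rw [x2, t'.pair_pair]; exact .refl a
    by_cases x3 : x = c
    · exact absurd (x3 ▸ hx) hnc
    by_cases x4 : x = t'.pair c
    · exact absurd (x4 ▸ hx) hnd
    rw [← cutPair_of_ne x1 x2 x3 x4]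
    exact hx.trans (.right x)
  · refine ⟨t'.pair c, by rw [t'.inc_pair, hac], not_linked_pair hS,
      hM.exchange_of_path _ (not_linked_pair hS) ?_ ?_⟩
    · rw [t'.pair_pair, cutPair_pair]
      exact hl
    · intro ε p1 p2
      rw [t'.pair_pair] at p2 ⊢
      exact hcol ε p1 fun x x1 x2 x3 x4 => p2 x x1 x2 x4 x3
  · exact ⟨c, hac, hS, hM.exchange_of_path hac hS hl hcol⟩

end

/-- In a connected graph, if all half-edges at each vertex are on the same circuit, there is only
one circuit. -/
theorem sameCircuit_of_vertex (hG : G.Connected)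
    (h : ∀ h h', G.inc h = G.inc h' → t'.SameCircuit h h') (x y : H) : t'.SameCircuit x y := by
  have key : ∀ v, Relation.ReflTransGen (fun u w => ∃ k ∈ G.whole.halves, G.inc k = u ∧
      G.inc (G.mate k) = w) (G.inc x) v → ∀ z, G.inc z = v → t'.SameCircuit x z := by
    intro v hv
    induction hv with
    | refl => exact fun z hz => h x z hz.symm
    | tail _ hk ih =>
      obtain ⟨k, -, hk1, rfl⟩ := hk
      exact fun z hz => ((ih k hk1).trans (.left k)).trans (h _ z hz.symm)
  exact key _ (hG.2 _ trivial _ trivial) y rfl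

/-- If the incidence graph of vertices and circuits of `t` has a cycle, there is a nonorientable
complementary transition system with only one circuit. -/
theorem exists_complementary_not_coherent [Finite H] (hG : G.Connected) (ht : ¬ t.TreeLike) :
    ∃ t' : G.TransitionSystem, ¬ t.Coherent t' ∧ t.Complementary t' ∧ ∀ x y, t'.SameCircuit x y := by
  obtain ⟨t', hM, hc⟩ := t.exists_complementary (fun t' => t.MergeState t') t.mergeState_self
    (fun t' a c hac hM hS => hM.exists_exchange hac hS)
  refine ⟨t', fun hcoh => ht fun f hf => ?_, hc, sameCircuit_of_vertex hG fun h h' e => ?_⟩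
  · obtain ⟨φ, ψ, hφ, hψ, hfe⟩ := hM.treeLike hcoh f hf
    refine ⟨Function.extend G.inc φ fun _ => false, ψ, hψ, fun h => ?_⟩
    have hfac : Function.FactorsThrough φ G.inc := fun x y e =>
      (hc x y e).apply_eq (fun h => (hφ h).1) (fun h => (hφ h).2)
    rw [hfe, hfac.extend_apply]
  · exact (hc h h' e).mono hM.sameCircuit .right

/-- If the incidence graph is acyclic, every complementary transition system is coherent. -/
theorem TreeLike.coherent [Finite H] (ht : t.TreeLike) (t' : G.TransitionSystem) :
    t.Coherent t' := by
  obtain ⟨ε, hε⟩ := exists_alternating G.mate_involutive t.pair_pair G.mate_ne t.pair_ne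
  obtain ⟨δ, hδ⟩ := exists_alternating t.pair_pair t'.pair_pair t.pair_ne t'.pair_ne
  obtain ⟨φ, ψ, hψ, hf⟩ := ht (fun h => xor (ε h) (δ h)) (fun h => by simp [hε, hδ])
  have key : ∀ h, xor (ε h) (ψ h) = xor (δ h) (φ (G.inc h)) := fun h => by
    have := hf h
    revert this
    cases ε h <;> cases δ h <;> cases φ (G.inc h) <;> cases ψ h <;> simp
  refine ⟨fun h => xor (ε h) (ψ h), fun h => ⟨?_, ?_, ?_⟩⟩
  · simp [hε, hψ]
  · simp [hε, hψ]
  · simp only [key, hδ, t'.inc_pair, Bool.not_xor]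

/-- If the incidence graph is acyclic, every pair `{a, pair a}` can be cut off: there is a union of
circuits that contains the pair and no other half-edge at its vertex, and that contains all or none
of the half-edges at every other vertex. -/
theorem TreeLike.exists_cut (ht : t.TreeLike) (a : H) :
    ∃ X : Set H, (∀ h, G.mate h ∈ X ↔ h ∈ X) ∧ (∀ h, t.pair h ∈ X ↔ h ∈ X) ∧ a ∈ X ∧
      (∀ h ∈ X, G.inc h = G.inc a → h = a ∨ h = t.pair a) ∧
      ∀ h h', G.inc h = G.inc h' → G.inc h ≠ G.inc a → (h ∈ X ↔ h' ∈ X) := by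
  classical
  obtain ⟨φ, ψ, hψ, hf⟩ := ht (fun h => decide (h = a ∨ h = t.pair a)) (fun h => by
    congr 1
    refine propext ⟨?_, ?_⟩
    · rintro (h | h)
      · exact Or.inr (by rw [← h, t.pair_pair])
      · exact Or.inl (t.pair_pair.injective h)
    · rintro (rfl | rfl)
      · exact Or.inr rfl
      · exact Or.inl (t.pair_pair _))
  have hfa := hf a
  simp only [true_or, decide_true] at hfa
  refine ⟨{h | ψ h = ψ a}, fun h => by simp [hψ], fun h => by simp [hψ], rfl, ?_, ?_⟩
  · intro h hh e
    have := hf h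
    rw [e, show ψ h = ψ a from hh, ← hfa] at this
    simpa using this
  · intro h h' e ne
    have key : ∀ x, G.inc x ≠ G.inc a → ψ x = φ (G.inc x) := fun x hx => by
      have h1 := hf x
      have h2 : ¬ (x = a ∨ x = t.pair a) := by
        rintro (rfl | rfl)
        · exact hx rfl
        · exact hx (t.inc_pair a)
      simp only [h2, decide_false] at h1
      revert h1
      cases ψ x <;> cases φ (G.inc x) <;> simp
    simp only [Set.mem_ofPred_eq, key h ne, key h' (e ▸ ne), e]

/-- If the incidence graph is acyclic, every complementary transition system has only one
circuit. -/
theorem TreeLike.sameCircuit [Finite H] (hG : G.Connected) (ht : t.TreeLike)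
    (hc : t.Complementary t') (x y : H) : t'.SameCircuit x y := by
  refine sameCircuit_of_vertex hG (fun h h' e => (hc h h' e).mono (fun a => ?_) .right) x y
  obtain ⟨X, hX1, -, haX, hXa, hX⟩ := ht.exists_cut a
  by_contra hna
  -- The part of the circuit of `t'` through `a` that lies in the cut-off set would be a path with
  -- `a` as its only end.
  refine not_paired_off_one G.mate_involutive G.mate_ne (Y := {x | x ∈ X ∧ t'.SameCircuit a x})
    (fun x hx => ⟨(hX1 x).2 hx.1, hx.2.trans (.left x)⟩) ⟨haX, .refl a⟩ t'.pair ?_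
  rintro x ⟨hx1, hx2⟩ hxa
  have hxv : G.inc x ≠ G.inc a := fun e => by
    rcases hXa x hx1 e with rfl | rfl
    · exact hxa rfl
    · exact hna hx2
  refine ⟨⟨(hX x (t'.pair x) (t'.inc_pair x).symm hxv).1 hx1, hx2.trans (.right x)⟩, ?_,
    t'.pair_ne x, t'.pair_pair x⟩
  intro e
  exact hxv (by rw [← e, t'.inc_pair])

end TransitionSystem

end HalfEdgeGraph

/-! ### Blocks, cycles and circuits -/

namespace HalfEdgeGraph

variable {V H : Type*} {G : HalfEdgeGraph V H}

theorem eq_or_eq_of_ncard_eq_two {X : Type*} {S : Set X} (hS : S.ncard = 2) {a b x : X}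
    (ha : a ∈ S) (hb : b ∈ S) (hab : a ≠ b) (hx : x ∈ S) : x = a ∨ x = b := by
  obtain ⟨p, q, -, rfl⟩ := Set.ncard_eq_two.1 hS
  simp only [Set.mem_insert_iff, Set.mem_singleton_iff] at *
  rcases ha with rfl | rfl <;> rcases hb with rfl | rfl <;> tauto

namespace Subgraph

instance : Preorder G.Subgraph where
  le_refl _ := ⟨subset_rfl, subset_rfl⟩
  le_trans _ _ _ h h' := ⟨h.1.trans h'.1, h.2.trans h'.2⟩

instance [Finite V] [Finite H] : Finite G.Subgraph :=
  Finite.of_injective (fun A : G.Subgraph => (A.verts, A.halves)) fun _ _ h =>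
    Subgraph.ext (congrArg Prod.fst h) (congrArg Prod.snd h)

theorem exists_block_ge [Finite V] [Finite H] {D : G.Subgraph} (hD : D.Nonseparable) :
    ∃ B : G.Subgraph, D ≤ B ∧ B.IsBlock :=
  (Set.toFinite {A : G.Subgraph | A.Nonseparable}).exists_le_maximal hD

/-- One step of a walk in a subgraph. -/
def Step (D : G.Subgraph) (x y : V) : Prop :=
  ∃ h ∈ D.halves, G.inc h = x ∧ G.inc (G.mate h) = y

theorem step_symm {D : G.Subgraph} {x y : V} (h : D.Step x y) : D.Step y x := by
  obtain ⟨k, hk, rfl, rfl⟩ := h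
  exact ⟨G.mate k, D.mate_mem k hk, rfl, by rw [G.mate_mate]⟩

theorem walk_symm {D : G.Subgraph} {x y : V} (h : Relation.ReflTransGen D.Step x y) :
    Relation.ReflTransGen D.Step y x := by
  induction h with
  | refl => exact .refl
  | tail _ h ih => exact .head (step_symm h) ih

theorem connected_of_walks {D : G.Subgraph} {v : V} (hv : v ∈ D.verts)
    (h : ∀ u ∈ D.verts, Relation.ReflTransGen D.Step u v) : D.Connected :=
  ⟨⟨v, hv⟩, fun _ hu _ hw => (h _ hu).trans (walk_symm (h _ hw))⟩

theorem Connected.exists_half {D : G.Subgraph} (hD : D.Connected) (hne : D.halves.Nonempty) {v : V}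
    (hv : v ∈ D.verts) : ∃ h ∈ D.halves, G.inc h = v := by
  obtain ⟨k, hk⟩ := hne
  rcases Relation.ReflTransGen.cases_head (hD.2 v hv _ (D.inc_mem k hk)) with h | ⟨_, h, -⟩
  · exact ⟨k, hk, h.symm⟩
  · obtain ⟨h, hh, e, -⟩ := h
    exact ⟨h, hh, e⟩

theorem IsSeparation.symm {D A B : G.Subgraph} (h : D.IsSeparation A B) : D.IsSeparation B A := by
  obtain ⟨h1, h2, h3, h4, h5, h6, h7, h8⟩ := h
  exact ⟨h2, h1, h4, h3, Set.union_comm _ _ ▸ h5, h6.symm, Set.union_comm _ _ ▸ h7,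
    Set.inter_comm _ _ ▸ h8⟩

/-- The part of `D` whose edges lie in `X`, together with the vertex `v`. -/
def part (D : G.Subgraph) (v : V) (X : Set H) (hX : ∀ h, G.mate h ∈ X ↔ h ∈ X) : G.Subgraph where
  verts := {u | u ∈ D.verts ∧ (u = v ∨ ∃ h ∈ D.halves ∩ X, G.inc h = u)}
  halves := D.halves ∩ X
  mate_mem h hh := ⟨D.mate_mem h hh.1, (hX h).2 hh.2⟩
  inc_mem h hh := ⟨D.inc_mem h hh.1, Or.inr ⟨h, hh, rfl⟩⟩

theorem part_connected {D : G.Subgraph} (hD : D.Connected) {v : V} (hv : v ∈ D.verts) {X : Set H}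
    (hX : ∀ h, G.mate h ∈ X ↔ h ∈ X)
    (hcut : ∀ h ∈ D.halves, ∀ h' ∈ D.halves, G.inc h = G.inc h' → G.inc h ≠ v →
      (h ∈ X ↔ h' ∈ X)) : (D.part v X hX).Connected := by
  refine connected_of_walks (v := v) ⟨hv, Or.inl rfl⟩ fun u hu => ?_
  have hw : Relation.ReflTransGen D.Step u v := hD.2 u hu.1 v hv
  induction hw using Relation.ReflTransGen.head_induction_on with
  | refl => exact .refl
  | head hg _ ih =>
    rename_i u w _
    by_cases huv : u = v
    · rw [huv]
    obtain ⟨g, hg, rfl, rfl⟩ := hg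
    obtain ⟨h, hh, e⟩ := hu.2.resolve_left huv
    have hgX : g ∈ X := (hcut h hh.1 g hg e (e ▸ huv)).1 hh.2
    have hg' : g ∈ (D.part v X hX).halves := ⟨hg, hgX⟩
    exact .head ⟨g, hg', rfl, rfl⟩ (ih ((D.part v X hX).inc_mem _ ((D.part v X hX).mate_mem g hg')))

/-- A connected subgraph is separable at `v` if its edges fall into two nonempty classes that meet
only at `v`. -/
theorem not_nonseparable_of_cut {D : G.Subgraph} {v : V} (hv : v ∈ D.verts) {X : Set H}
    (hX : ∀ h, G.mate h ∈ X ↔ h ∈ X)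
    (hcut : ∀ h ∈ D.halves, ∀ h' ∈ D.halves, G.inc h = G.inc h' → G.inc h ≠ v →
      (h ∈ X ↔ h' ∈ X)) (h1 : (D.halves ∩ X).Nonempty) (h2 : (D.halves ∩ Xᶜ).Nonempty) :
    ¬ D.Nonseparable := by
  rintro ⟨hD, hns⟩
  have hX' : ∀ h, G.mate h ∈ Xᶜ ↔ h ∈ Xᶜ := fun h => not_congr (hX h)
  refine hns ⟨D.part v X hX, D.part v Xᶜ hX', part_connected hD hv hX hcut,
    part_connected hD hv hX' (fun h hh h' hh' e ne => not_congr (hcut h hh h' hh' e ne)), h1, h2,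
    ?_, ?_, ?_, v, ?_⟩
  · exact Set.inter_union_compl _ _
  · exact disjoint_compl_right.mono Set.inter_subset_right Set.inter_subset_right
  · ext u
    constructor
    · rintro (h | h)
      exacts [h.1, h.1]
    · intro hu
      obtain ⟨h, hh, rfl⟩ := hD.exists_half (h1.mono Set.inter_subset_left) hu
      by_cases hx : h ∈ X
      · exact Or.inl ⟨hu, Or.inr ⟨h, ⟨hh, hx⟩, rfl⟩⟩
      · exact Or.inr ⟨hu, Or.inr ⟨h, ⟨hh, hx⟩, rfl⟩⟩
  · ext u
    constructor
    · rintro ⟨⟨-, h⟩, -, h'⟩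
      by_contra hne
      obtain ⟨k, hk, rfl⟩ := h.resolve_left hne
      obtain ⟨k', hk', e⟩ := h'.resolve_left hne
      exact hk'.2 ((hcut k hk.1 k' hk'.1 e.symm hne).1 hk.2)
    · rintro rfl
      exact ⟨⟨hv, Or.inl rfl⟩, hv, Or.inl rfl⟩

end Subgraph

namespace TransitionSystem

variable {t : G.TransitionSystem}

/-- Every circuit of `t` is a cycle: it visits each of its vertices only once. -/
def VisitsOnce (t : G.TransitionSystem) : Prop :=
  ∀ h k, t.SameCircuit h k → G.inc k = G.inc h → k = h ∨ k = t.pair h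

theorem pair_mem_of_isSeparation [Finite H] (ht : t.VisitsOnce) {D A₁ A₂ : G.Subgraph}
    (hD : ∀ h ∈ D.halves, t.pair h ∈ D.halves) (hs : D.IsSeparation A₁ A₂) (h : H)
    (hh : h ∈ A₁.halves) : t.pair h ∈ A₁.halves := by
  obtain ⟨-, -, -, -, hun, hdis, -, v, hv⟩ := hs
  have key : ∀ x ∈ A₁.halves, t.pair x ∉ A₁.halves → t.pair x ∈ A₂.halves ∧ G.inc x = v := by
    intro x hx hpx
    have h2 : t.pair x ∈ A₂.halves :=
      (hun.symm ▸ hD x (hun ▸ Or.inl hx) : t.pair x ∈ A₁.halves ∪ A₂.halves).resolve_left hpx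
    have : G.inc x ∈ A₁.verts ∩ A₂.verts :=
      ⟨A₁.inc_mem x hx, t.inc_pair x ▸ A₂.inc_mem _ h2⟩
    rw [hv] at this
    exact ⟨h2, this⟩
  by_contra hph
  -- The part in `A₁` of the circuit through `h` would be a path with `h` as its only end.
  refine not_paired_off_one G.mate_involutive G.mate_ne (Y := {x | x ∈ A₁.halves ∧ t.SameCircuit h x})
    (fun x hx => ⟨A₁.mate_mem x hx.1, hx.2.trans (.left x)⟩) ⟨hh, .refl h⟩ t.pair ?_
  rintro x ⟨hx, hl⟩ hxh
  refine ⟨⟨?_, hl.trans (.right x)⟩, ?_, t.pair_ne x, t.pair_pair x⟩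
  · by_contra hpx
    rcases ht h x hl ((key x hx hpx).2.trans (key h hh hph).2.symm) with rfl | rfl
    · exact hxh rfl
    · exact hph hx
  · rintro rfl
    rw [t.pair_pair] at hph
    exact hph hx

/-- If all blocks are cycles and all circuits of `t` are cycles, then the incidence graph is
acyclic. A connected union of circuits is either contained in a block, in which case it is a single
cycle, or it is split at a cut vertex into two smaller unions of circuits. -/
theorem treeLike_of_isTreeOfCycles [Finite V] [Finite H] (hG : G.IsTreeOfCycles)
    (ht : t.VisitsOnce) : t.TreeLike := by
  classical
  intro f hf
  have key : ∀ (n : ℕ) (D : G.Subgraph), D.halves.ncard = n → D.Connected →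
      (∀ h ∈ D.halves, t.pair h ∈ D.halves) → ∃ (φ : V → Bool) (ψ : H → Bool),
        (∀ h ∈ D.halves, ψ (G.mate h) = ψ h ∧ ψ (t.pair h) = ψ h) ∧
        ∀ h ∈ D.halves, f h = xor (φ (G.inc h)) (ψ h) := by
    intro n
    induction n using Nat.strong_induction_on with
    | _ n ih =>
      intro D hn hD htD
      by_cases hsep : ∃ A₁ A₂ : G.Subgraph, D.IsSeparation A₁ A₂
      · obtain ⟨A₁, A₂, hs⟩ := hsep
        have ht1 := pair_mem_of_isSeparation ht htD hs
        have ht2 := pair_mem_of_isSeparation ht htD hs.symm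
        obtain ⟨c1, c2, ⟨k1, hk1⟩, ⟨k2, hk2⟩, hun, hdis, -, v, hv⟩ := hs
        have s1 : A₁.halves ⊂ D.halves := by
          rw [← hun]
          exact ⟨Set.subset_union_left, fun h => Set.disjoint_right.1 hdis hk2 (h (Or.inr hk2))⟩
        have s2 : A₂.halves ⊂ D.halves := by
          rw [← hun]
          exact ⟨Set.subset_union_right, fun h => Set.disjoint_left.1 hdis hk1 (h (Or.inl hk1))⟩
        obtain ⟨φ₁, ψ₁, hψ₁, hf₁⟩ := ih _ (hn ▸ Set.ncard_lt_ncard s1) A₁ rfl c1 ht1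
        obtain ⟨φ₂, ψ₂, hψ₂, hf₂⟩ := ih _ (hn ▸ Set.ncard_lt_ncard s2) A₂ rfl c2 ht2
        -- The functions on the two parts are adjusted so as to agree at the cut vertex.
        let δ := xor (φ₁ v) (φ₂ v)
        refine ⟨fun u => if u ∈ A₁.verts then φ₁ u else xor (φ₂ u) δ,
          fun h => if h ∈ A₁.halves then ψ₁ h else xor (ψ₂ h) δ, ?_, ?_⟩
        · intro h hh
          rw [← hun] at hh
          rcases hh with hh | hh
          · simp [hh, ht1 h hh, A₁.mate_mem h hh, hψ₁ h hh]
          · have hn : ∀ x ∈ A₂.halves, x ∉ A₁.halves := fun x hx => Set.disjoint_right.1 hdis hx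
            simp [hn h hh, hn _ (ht2 h hh), hn _ (A₂.mate_mem h hh), hψ₂ h hh]
        · intro h hh
          rw [← hun] at hh
          rcases hh with hh | hh
          · simp [hh, A₁.inc_mem h hh, hf₁ h hh]
          · have h1 : h ∉ A₁.halves := Set.disjoint_right.1 hdis hh
            rw [hf₂ h hh]
            by_cases hi : G.inc h ∈ A₁.verts
            · have : G.inc h ∈ A₁.verts ∩ A₂.verts := ⟨hi, A₂.inc_mem h hh⟩
              rw [hv] at this
              have e : G.inc h = v := this
              rw [e] at hi
              simp only [h1, hi, if_true, if_false, e, δ]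
              cases φ₁ v <;> cases φ₂ v <;> cases ψ₂ h <;> rfl
            · simp only [h1, hi, if_false]
              cases φ₂ (G.inc h) <;> cases ψ₂ h <;> cases δ <;> rfl
      · obtain ⟨B, hDB, hB⟩ := Subgraph.exists_block_ge ⟨hD, hsep⟩
        have hB2 := (hG.2 B hB).2
        refine ⟨fun v => if hv : ∃ h ∈ D.halves, G.inc h = v then f hv.choose else false,
          fun _ => false, fun _ _ => ⟨rfl, rfl⟩, fun h hh => ?_⟩
        have hv : ∃ k ∈ D.halves, G.inc k = G.inc h := ⟨h, hh, rfl⟩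
        simp only [hv, dif_pos, Bool.xor_false]
        have hc := hv.choose_spec
        rcases eq_or_eq_of_ncard_eq_two (hB2 _ (B.inc_mem h (hDB.2 hh))) ⟨hDB.2 hh, rfl⟩
          ⟨hDB.2 (htD h hh), t.inc_pair h⟩ (t.pair_ne h).symm ⟨hDB.2 hc.1, hc.2⟩ with e | e
        · rw [e]
        · rw [e, hf]
  obtain ⟨φ, ψ, h1, h2⟩ := key _ G.whole rfl hG.1 fun _ _ => trivial
  exact ⟨φ, ψ, fun h => h1 h trivial, fun h => h2 h trivial⟩

theorem TreeLike.visitsOnce (ht : t.TreeLike) : t.VisitsOnce := by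
  intro h k hl e
  obtain ⟨X, hX1, hX2, hh, hXh, -⟩ := ht.exists_cut h
  exact hXh k (hl.of_closed G.mate_involutive t.pair_pair (fun x => (hX1 x).2)
    (fun x => (hX2 x).2) hh) e

/-- The circuit through a half-edge, as a subgraph. -/
def circuitSubgraph (t : G.TransitionSystem) (a : H) : G.Subgraph where
  verts := {u | ∃ h, t.SameCircuit a h ∧ G.inc h = u}
  halves := {h | t.SameCircuit a h}
  mate_mem _ hh := Linked.trans hh (.left _)
  inc_mem h hh := ⟨h, hh, rfl⟩

theorem circuitSubgraph_connected (a : H) : (t.circuitSubgraph a).Connected := by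
  refine Subgraph.connected_of_walks (v := G.inc a) ⟨a, .refl a, rfl⟩ ?_
  rintro _ ⟨h, hh, rfl⟩
  refine Subgraph.walk_symm ?_
  refine (hh.of_closed G.mate_involutive t.pair_pair (P := fun x => t.SameCircuit a x ∧
    Relation.ReflTransGen (t.circuitSubgraph a).Step (G.inc a) (G.inc x)) ?_ ?_ ⟨.refl a, .refl⟩).2
  · rintro x ⟨h1, h2⟩
    exact ⟨h1.trans (.left x), h2.tail ⟨x, h1, rfl, rfl⟩⟩
  · rintro x ⟨h1, h2⟩
    exact ⟨h1.trans (.right x), t.inc_pair x ▸ h2⟩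

theorem VisitsOnce.nonseparable [Finite H] (ht : t.VisitsOnce) (a : H) :
    (t.circuitSubgraph a).Nonseparable := by
  refine ⟨circuitSubgraph_connected a, ?_⟩
  rintro ⟨A₁, A₂, hs⟩
  have ht1 := pair_mem_of_isSeparation ht (D := t.circuitSubgraph a)
    (fun h hh => Linked.trans hh (.right h)) hs
  obtain ⟨c1, c2, n1, n2, hun, hdis, -, v, hv⟩ := hs
  have hv' : v ∈ A₁.verts ∩ A₂.verts := hv ▸ rfl
  obtain ⟨h, hh, rfl⟩ := c1.exists_half n1 hv'.1
  obtain ⟨k, hk, e⟩ := c2.exists_half n2 hv'.2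
  have e1 : t.SameCircuit a h := (hun ▸ Or.inl hh : h ∈ (t.circuitSubgraph a).halves)
  have e2 : t.SameCircuit a k := (hun ▸ Or.inr hk : k ∈ (t.circuitSubgraph a).halves)
  rcases ht h k (e1.symm.trans e2) e with rfl | rfl
  · exact Set.disjoint_left.1 hdis hh hk
  · exact Set.disjoint_left.1 hdis (ht1 h hh) hk

theorem VisitsOnce.ncard_eq_two (ht : t.VisitsOnce) {a h : H} (hh : t.SameCircuit a h) :
    {k | t.SameCircuit a k ∧ G.inc k = G.inc h}.ncard = 2 := by
  rw [Set.ncard_eq_two]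
  refine ⟨h, t.pair h, (t.pair_ne h).symm, Set.ext fun k => ⟨?_, ?_⟩⟩
  · rintro ⟨h1, h2⟩
    exact ht h k (hh.symm.trans h1) h2
  · rintro (rfl | rfl)
    · exact ⟨hh, rfl⟩
    · exact ⟨hh.trans (.right h), t.inc_pair h⟩

/-- If the incidence graph is acyclic, a nonseparable subgraph with an edge lies in a single
circuit. -/
theorem TreeLike.le_circuitSubgraph (ht : t.TreeLike) {D : G.Subgraph}
    (hD : D.Nonseparable) {a : H} (ha : a ∈ D.halves) : D ≤ t.circuitSubgraph a := by
  have hvert : ∀ h ∈ D.halves, ∀ k ∈ D.halves, G.inc h = G.inc k → t.SameCircuit h k := by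
    intro h hh k hk e
    by_contra hl
    obtain ⟨X, hX1, hX2, hhX, hXh, hX⟩ := ht.exists_cut h
    refine Subgraph.not_nonseparable_of_cut (D.inc_mem h hh) hX1
      (fun x _ y _ exy ne => hX x y exy ne) ⟨h, hh, hhX⟩ ⟨k, hk, fun hkX => ?_⟩ hD
    rcases hXh k hkX e.symm with rfl | rfl
    · exact hl (.refl _)
    · exact hl (.right _)
  have key : ∀ v, Relation.ReflTransGen D.Step (G.inc a) v → ∀ z ∈ D.halves, G.inc z = v →
      t.SameCircuit a z := by
    intro v hv
    induction hv with
    | refl => exact fun z hz e => hvert a ha z hz e.symm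
    | tail _ hk ih =>
      obtain ⟨k, hkD, hk1, rfl⟩ := hk
      exact fun z hz e => ((ih k hkD hk1).trans (.left k)).trans
        (hvert _ (D.mate_mem k hkD) z hz e.symm)
  have hhal : D.halves ⊆ (t.circuitSubgraph a).halves := fun z hz =>
    key _ (hD.1.2 _ (D.inc_mem a ha) _ (D.inc_mem z hz)) z hz rfl
  refine ⟨fun u hu => ?_, hhal⟩
  obtain ⟨h, hh, rfl⟩ := hD.1.exists_half ⟨a, ha⟩ hu
  exact ⟨h, hhal hh, rfl⟩

theorem TreeLike.isTreeOfCycles [Finite H] [Nonempty H] (hG : G.Connected)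
    (ht : t.TreeLike) : G.IsTreeOfCycles := by
  refine ⟨hG, fun B hB => ?_⟩
  obtain ⟨a, hle⟩ : ∃ a, B ≤ t.circuitSubgraph a := by
    rcases B.halves.eq_empty_or_nonempty with h0 | ⟨a, ha⟩
    · obtain ⟨⟨v, hv⟩, hw⟩ := hB.1.1
      obtain ⟨a, -, rfl⟩ := Subgraph.Connected.exists_half hG Set.univ_nonempty (Set.mem_univ v)
      refine ⟨a, fun u hu => ⟨a, .refl a, ?_⟩, by simp [h0]⟩
      rcases Relation.ReflTransGen.cases_head (hw _ hv u hu) with h | ⟨_, ⟨k, hk, -⟩, -⟩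
      · exact h
      · exact absurd hk (by simp [h0])
    · exact ⟨a, ht.le_circuitSubgraph hB.1 ha⟩
  have hge := hB.2 (ht.visitsOnce.nonseparable a) hle
  have hBe : B = t.circuitSubgraph a := Subgraph.ext (hle.1.antisymm hge.1) (hle.2.antisymm hge.2)
  rw [hBe]
  refine ⟨circuitSubgraph_connected a, ?_⟩
  rintro _ ⟨h, hh, rfl⟩
  exact ht.visitsOnce.ncard_eq_two hh

/-- If the incidence graph is acyclic, the transitions in every `2`-regular subgraph are those of
`t`. -/
theorem TreeLike.eq_pair [Finite H] (ht : t.TreeLike) {U : Set H}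
    (hU : ∀ h ∈ U, G.mate h ∈ U) (hU2 : ∀ h ∈ U, {k | k ∈ U ∧ G.inc k = G.inc h}.ncard = 2)
    {a b : H} (ha : a ∈ U) (hb : b ∈ U) (hab : a ≠ b) (e : G.inc b = G.inc a) : b = t.pair a := by
  by_cases hpa : t.pair a ∈ U
  · exact (eq_or_eq_of_ncard_eq_two (hU2 a ha) ⟨ha, rfl⟩ ⟨hpa, t.inc_pair a⟩ (t.pair_ne a).symm
      ⟨hb, e⟩).resolve_left hab.symm
  exfalso
  have hex : ∀ h : U, ∃ k, k ∈ U ∧ G.inc k = G.inc h ∧ k ≠ h := by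
    rintro ⟨h, hh⟩
    obtain ⟨x, hx, hne⟩ := Set.exists_ne_of_one_lt_ncard (by rw [hU2 h hh]; norm_num) h
    exact ⟨x, hx.1, hx.2, hne⟩
  choose! σ hσ using fun (h : H) (hh : h ∈ U) => hex ⟨h, hh⟩
  obtain ⟨X, hX1, -, haX, hXa, hX⟩ := ht.exists_cut a
  refine not_paired_off_one G.mate_involutive G.mate_ne (Y := U ∩ X)
    (fun x hx => ⟨hU x hx.1, (hX1 x).2 hx.2⟩) ⟨ha, haX⟩ σ ?_
  rintro x ⟨hxU, hxX⟩ hxa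
  have hxv : G.inc x ≠ G.inc a := fun e => by
    rcases hXa x hxX e with rfl | rfl
    · exact hxa rfl
    · exact hpa hxU
  obtain ⟨h1, h2, h3⟩ := hσ x hxU
  obtain ⟨h1', h2', h3'⟩ := hσ (σ x) h1
  refine ⟨⟨h1, (hX x _ h2.symm hxv).1 hxX⟩, fun e => hxv (by rw [← e, h2]), h3, ?_⟩
  exact (eq_or_eq_of_ncard_eq_two (hU2 x hxU) ⟨hxU, rfl⟩ ⟨h1, h2⟩ h3.symm
    ⟨h1', h2'.trans h2⟩).resolve_right h3'

end TransitionSystem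

end HalfEdgeGraph

/-! ### Counting -/

namespace HalfEdgeGraph

variable {V H : Type*} {G : HalfEdgeGraph V H}

theorem edge_eq_iff (G : HalfEdgeGraph V H) (x y : H) :
    G.edge x = G.edge y ↔ y = x ∨ y = G.mate x := by
  simp only [edge, Sym2.eq_iff]
  constructor
  · rintro (⟨h, -⟩ | ⟨-, h⟩)
    exacts [Or.inl h.symm, Or.inr h.symm]
  · rintro (rfl | rfl)
    · exact Or.inl ⟨rfl, rfl⟩
    · exact Or.inr ⟨(G.mate_mate x).symm, rfl⟩

namespace TransitionSystem

variable {t t' : G.TransitionSystem}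

/-- The circuits of a transition system. -/
def Circuit (t : G.TransitionSystem) : Type _ := Quot fun x y : H => y = G.mate x ∨ y = t.pair x

instance [Finite H] : Finite t.Circuit := inferInstanceAs (Finite (Quot _))

/-- The circuit through a half-edge. -/
def circuit (t : G.TransitionSystem) (h : H) : t.Circuit := Quot.mk _ h

theorem circuit_eq_iff {x y : H} : t.circuit x = t.circuit y ↔ t.SameCircuit x y := Quot.eq

theorem circuit_mate (x : H) : t.circuit (G.mate x) = t.circuit x :=
  circuit_eq_iff.2 (Linked.left x).symm

theorem circuit_pair (x : H) : t.circuit (t.pair x) = t.circuit x :=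
  circuit_eq_iff.2 (Linked.right x).symm

/-- A tree has one node more than it has edges. The edges of the incidence graph are the pairs of
`t`, and there are as many of them as there are edges in the graph. -/
theorem TreeLike.card_add_card [Finite V] [Finite H] (hG : G.Connected) (ht : t.TreeLike) :
    Nat.card V + Nat.card t.Circuit = G.edgeSet.ncard + 1 := by
  let pr : H → Sym2 H := fun h => s(h, t.pair h)
  have hpr : ∀ x y, pr x = pr y ↔ y = x ∨ y = t.pair x := by
    intro x y
    simp only [pr, Sym2.eq_iff]
    constructor
    · rintro (⟨h, -⟩ | ⟨-, h⟩)
      exacts [Or.inl h.symm, Or.inr h.symm]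
    · rintro (rfl | rfl)
      · exact Or.inl ⟨rfl, rfl⟩
      · exact Or.inr ⟨(t.pair_pair x).symm, rfl⟩
  have hcard : (Set.range pr).ncard = G.edgeSet.ncard := by
    have h1 := two_mul_ncard_range t.pair_ne hpr
    have h2 := two_mul_ncard_range G.mate_ne G.edge_eq_iff
    rw [edgeSet]
    omega
  obtain ⟨v₀, -⟩ := hG.1
  choose r hr using fun p : Set.range pr => p.2
  have hr' : ∀ h, r ⟨pr h, h, rfl⟩ = h ∨ r ⟨pr h, h, rfl⟩ = t.pair h := fun h =>
    (hpr _ _).1 (hr ⟨pr h, h, rfl⟩).symm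
  -- A cochain on the nodes is determined by its value at one vertex and its coboundary.
  let F : (V → Bool) × (t.Circuit → Bool) → Bool × (Set.range pr → Bool) := fun x =>
    (x.1 v₀, fun p => xor (x.1 (G.inc (r p))) (x.2 (t.circuit (r p))))
  have hF : ∀ x h, (F x).2 ⟨pr h, h, rfl⟩ = xor (x.1 (G.inc h)) (x.2 (t.circuit h)) := by
    intro x h
    simp only [F]
    rcases hr' h with e | e <;> rw [e]
    rw [t.inc_pair, circuit_pair]
  have hinj : Function.Injective F := by
    rintro ⟨φ, χ⟩ ⟨φ', χ'⟩ e
    have h0 : φ v₀ = φ' v₀ := congrArg Prod.fst e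
    have h1 : ∀ h, xor (φ (G.inc h)) (φ' (G.inc h)) = xor (χ (t.circuit h)) (χ' (t.circuit h)) := by
      intro h
      have h2 := hF (φ, χ) h
      rw [e, hF] at h2
      revert h2
      simp only
      cases φ (G.inc h) <;> cases φ' (G.inc h) <;> cases χ (t.circuit h) <;>
        cases χ' (t.circuit h) <;> simp
    have h2 : ∀ u, Relation.ReflTransGen G.whole.Step v₀ u → xor (φ u) (φ' u) = false := by
      intro u hu
      induction hu with
      | refl => simp [h0]
      | tail _ hk ih =>
        obtain ⟨k, -, rfl, rfl⟩ := hk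
        rw [h1, circuit_mate, ← h1, ih]
    have h3 : ∀ u, xor (φ u) (φ' u) = false := fun u => h2 u (hG.2 _ trivial _ trivial)
    refine Prod.ext (funext fun u => by simpa using h3 u) (funext fun q => ?_)
    induction q using Quot.inductionOn with
    | h h =>
      have := h1 h
      rw [h3] at this
      change χ (t.circuit h) = χ' (t.circuit h)
      simpa using this.symm
  have hsurj : Function.Surjective F := by
    rintro ⟨b, g⟩
    obtain ⟨φ, ψ, hψ, hf⟩ := ht (fun h => g ⟨pr h, h, rfl⟩) (fun h => by
      congr 2
      exact ((hpr _ _).2 (Or.inr rfl)).symm)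
    let χ : t.Circuit → Bool := Quot.lift ψ (by
      rintro x y (rfl | rfl)
      exacts [(hψ x).1.symm, (hψ x).2.symm])
    let c := xor (φ v₀) b
    let x : (V → Bool) × (t.Circuit → Bool) := (fun u => xor (φ u) c, fun q => xor (χ q) c)
    refine ⟨x, Prod.ext ?_ (funext ?_)⟩
    · change xor (φ v₀) (xor (φ v₀) b) = b
      simp
    · rintro ⟨_, h, rfl⟩
      rw [hF]
      refine Eq.trans ?_ (hf h).symm
      change xor (xor (φ (G.inc h)) c) (xor (ψ h) c) = _
      cases φ (G.inc h) <;> cases ψ h <;> cases c <;> rfl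
  have h := Nat.card_congr (Equiv.ofBijective F ⟨hinj, hsurj⟩)
  rw [Nat.card_prod, Nat.card_prod, Nat.card_fun, Nat.card_fun, Nat.card_fun,
    Nat.card_eq_fintype_card (α := Bool), Fintype.card_bool, ← pow_add, ← pow_succ',
    Nat.card_coe_set_eq, hcard] at h
  exact Nat.pow_right_injective le_rfl h

end TransitionSystem

end HalfEdgeGraph

/-! ### Cyclic sequences -/

namespace HalfEdgeGraph

section Cycles

variable {X Y : Type*}

/-- `b` follows `a` in the cyclic sequence `c`. -/
def Consecutive (c : Cycle X) (a b : X) : Prop :=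
  (c = ([a] : List X) ∧ b = a) ∨ ∃ l : List X, c = (a :: b :: l : List X)

theorem exists_cons_of_mem {c : Cycle X} {a : X} (ha : a ∈ c) : ∃ l : List X, c = (a :: l : List X) := by
  induction c using Quotient.inductionOn with
  | h l =>
    obtain ⟨s, s', rfl⟩ := List.append_of_mem (show a ∈ l from ha)
    exact ⟨s' ++ s, Cycle.coe_eq_coe.2 (by simpa using List.isRotated_append (l := s) (l' := a :: s'))⟩

theorem exists_consecutive {c : Cycle X} {a : X} (ha : a ∈ c) : ∃ b, Consecutive c a b := by
  obtain ⟨l, rfl⟩ := exists_cons_of_mem ha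
  cases l with
  | nil => exact ⟨a, Or.inl ⟨rfl, rfl⟩⟩
  | cons b l => exact ⟨b, Or.inr ⟨l, rfl⟩⟩

namespace Consecutive

variable {c : Cycle X} {a b : X}

theorem left_mem (h : Consecutive c a b) : a ∈ c := by
  rcases h with ⟨rfl, -⟩ | ⟨l, rfl⟩ <;> simp

theorem right_mem (h : Consecutive c a b) : b ∈ c := by
  rcases h with ⟨rfl, rfl⟩ | ⟨l, rfl⟩ <;> simp

theorem map (h : Consecutive c a b) (f : X → Y) : Consecutive (c.map f) (f a) (f b) := by
  rcases h with ⟨rfl, rfl⟩ | ⟨l, rfl⟩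
  · exact Or.inl ⟨rfl, rfl⟩
  · exact Or.inr ⟨l.map f, rfl⟩

theorem reverse (h : Consecutive c a b) : Consecutive c.reverse b a := by
  rcases h with ⟨rfl, rfl⟩ | ⟨l, rfl⟩
  · exact Or.inl ⟨rfl, rfl⟩
  · refine Or.inr ⟨l.reverse, Cycle.coe_eq_coe.2 ?_⟩
    simpa using List.isRotated_append (l := l.reverse) (l' := [b, a])

theorem chain (h : Consecutive c a b) {r : X → X → Prop} (hc : c.Chain r) : r a b := by
  rcases h with ⟨rfl, rfl⟩ | ⟨l, rfl⟩
  · exact (Cycle.chain_singleton r b).1 hc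
  · exact (List.isChain_cons_cons.1 ((Cycle.chain_coe_cons r a (b :: l)).1 hc)).1

theorem next_eq [DecidableEq X] (h : Consecutive c a b) (hn : c.Nodup) (ha : a ∈ c) :
    c.next hn a ha = b := by
  rcases h with ⟨rfl, rfl⟩ | ⟨l, rfl⟩
  · exact List.next_singleton b b ha
  · exact List.next_cons_cons_eq l a b ha

theorem unique (h : Consecutive c a b) {b' : X} (h' : Consecutive c a b') (hn : c.Nodup) :
    b = b' := by
  classical
  rw [← h.next_eq hn h.left_mem, h'.next_eq hn h.left_mem]

end Consecutive

/-- A cyclic sequence without repetitions in which every element is followed by its image under `f`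
is an orbit of `f`. -/
theorem eq_periodicOrbit {f : X → X} {c : Cycle X} (hn : c.Nodup)
    (hf : ∀ a b, Consecutive c a b → b = f a) {x : X} (hx : x ∈ c) :
    c = Function.periodicOrbit f x := by
  classical
  obtain ⟨l, rfl⟩ := exists_cons_of_mem hx
  set L := x :: l with hL
  have hLn : L.Nodup := hn
  have hpos : 0 < L.length := by simp [hL]
  have hstep : ∀ i (hi : i < L.length), L[(i + 1) % L.length]'(Nat.mod_lt _ hpos) = f L[i] := by
    intro i hi
    obtain ⟨b, hb⟩ := exists_consecutive (c := (L : Cycle X)) (a := L[i]) (List.getElem_mem hi)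
    rw [← hf _ _ hb, ← hb.next_eq hn (List.getElem_mem hi)]
    exact (List.next_getElem L hLn i hi).symm
  have hit : ∀ i (hi : i < L.length), L[i] = f^[i] x := by
    intro i
    induction i with
    | zero => intro _; simp [hL]
    | succ i ih =>
      intro hi
      rw [Function.iterate_succ_apply', ← ih (by omega), ← hstep i (by omega)]
      congr 1
      exact (Nat.mod_eq_of_lt hi).symm
  have hper : Function.IsPeriodicPt f L.length x := by
    have h1 := hstep (L.length - 1) (by omega)
    rw [hit (L.length - 1) (by omega), ← Function.iterate_succ_apply' f] at h1
    simp only [show L.length - 1 + 1 = L.length by omega, Nat.mod_self,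
      show (L.length - 1).succ = L.length by omega] at h1
    exact h1.symm.trans (by simp [hL])
  have hmin : Function.minimalPeriod f x = L.length := by
    have hle := hper.minimalPeriod_le hpos
    refine hle.antisymm (not_lt.1 fun hlt => ?_)
    have h1 := hit _ hlt
    rw [Function.iterate_minimalPeriod] at h1
    have h2 : L[Function.minimalPeriod f x] = L[0] := h1.trans (by simp [hL])
    have := (hLn.getElem_inj_iff).1 h2
    exact (hper.minimalPeriod_pos hpos).ne' this
  rw [Function.periodicOrbit_def, hmin]
  congr 1
  exact List.ext_getElem (by simp) fun i h1 h2 => by simp [hit i h1]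

theorem periodicOrbit_reverse [Finite X] {f σ : X → X} (hf : Function.Injective f)
    (hσ : Function.Involutive σ) (h : ∀ x, f (σ (f x)) = σ x) (x : X) :
    Function.periodicOrbit f (σ x) = ((Function.periodicOrbit f x).reverse).map σ := by
  classical
  have hper : ∀ y, y ∈ Function.periodicPts f := fun y => hf.mem_periodicPts y
  have hmem : σ x ∈ ((Function.periodicOrbit f x).reverse).map σ :=
    Cycle.mem_map.2 ⟨x, Cycle.mem_reverse_iff.2 (Function.self_mem_periodicOrbit (hper x)), rfl⟩
  refine (eq_periodicOrbit ?_ ?_ hmem).symm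
  · have hn := (Function.nodup_periodicOrbit (f := f) (x := x))
    generalize Function.periodicOrbit f x = c at hn
    induction c using Quotient.inductionOn with
    | h l => exact (List.nodup_map_iff hσ.injective).2 (List.nodup_reverse.2 hn)
  · intro a b hab
    have h1 := (hab.map σ).reverse
    have e : ((((Function.periodicOrbit f x).reverse).map σ).map σ).reverse =
        Function.periodicOrbit f x := by
      generalize Function.periodicOrbit f x = c
      induction c using Quotient.inductionOn with
      | h l =>
        change (((((l.reverse).map σ).map σ).reverse : List X) : Cycle X) = (l : Cycle X)
        simp [Function.comp_def, hσ _]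
    rw [e] at h1
    have h2 : σ a = f (σ b) := h1.chain ((Function.periodicOrbit_chain' _ (hper x)).2 fun n => by
      rw [Function.iterate_succ_apply'] : Cycle.Chain (fun y z => z = f y) _)
    rw [← hσ b, ← h (σ b), ← h2, hσ a]

theorem mem_toMultiset {c : Cycle X} {x : X} : x ∈ c.toMultiset ↔ x ∈ c := by
  induction c using Quotient.inductionOn with
  | h l => rfl

theorem nodup_toMultiset {c : Cycle X} : c.toMultiset.Nodup ↔ c.Nodup := by
  induction c using Quotient.inductionOn with
  | h l => rfl

end Cycles

/-! ### Circuits of a transition system -/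

variable {V H : Type*} {G : HalfEdgeGraph V H}

namespace ClosedWalk

theorem exists_edge (W : G.ClosedWalk) : ∃ g, G.edge g ∈ W.edges := by
  induction W using Quotient.inductionOn with
  | h w =>
    obtain ⟨c, hc, -⟩ := w
    obtain ⟨g, hg⟩ := Multiset.exists_mem_of_ne_zero (mt Cycle.toMultiset_eq_nil.1 hc)
    exact ⟨g, Multiset.mem_map_of_mem _ hg⟩

end ClosedWalk

namespace DirClosedWalk

theorem nodup_of_edges {w : G.DirClosedWalk} (h : w.edges.Nodup) : w.1.Nodup :=
  nodup_toMultiset.1 (Multiset.Nodup.of_map _ h)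

/-- A circuit does not contain both halves of an edge in the same direction. -/
theorem mate_notMem {w : G.DirClosedWalk} (h : w.edges.Nodup) {x : H} (hx : x ∈ w.1) :
    G.mate x ∉ w.1 := fun hm =>
  G.mate_ne x (Multiset.inj_on_of_nodup_map h _ (mem_toMultiset.2 hm) _ (mem_toMultiset.2 hx)
    (G.edge_mate x))

theorem mem_edges {w : G.DirClosedWalk} {g : H} :
    G.edge g ∈ w.edges ↔ g ∈ w.1 ∨ G.mate g ∈ w.1 := by
  simp only [edges, Multiset.mem_map, mem_toMultiset]
  constructor
  · rintro ⟨x, hx, e⟩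
    rcases (G.edge_eq_iff g x).1 e.symm with rfl | rfl
    exacts [Or.inl hx, Or.inr hx]
  · rintro (h | h)
    exacts [⟨g, h, rfl⟩, ⟨_, h, G.edge_mate g⟩]

theorem mem_reverse {w : G.DirClosedWalk} {g : H} : G.mate g ∈ w.reverse.1 ↔ g ∈ w.1 := by
  change G.mate g ∈ (w.1.reverse).map G.mate ↔ _
  rw [Cycle.mem_map]
  simp only [Cycle.mem_reverse_iff]
  constructor
  · rintro ⟨x, hx, e⟩
    exact G.mate_involutive.injective e ▸ hx
  · exact fun h => ⟨g, h, rfl⟩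

theorem consecutive_reverse {w : G.DirClosedWalk} {a b : H} (h : Consecutive w.1 a b) :
    Consecutive w.reverse.1 (G.mate b) (G.mate a) := h.reverse.map G.mate

end DirClosedWalk

namespace TransitionSystem

variable (t : G.TransitionSystem)

/-- One step along a circuit: the edge of `h` is traversed, and the walk leaves its end along the
half-edge paired with that of arrival. -/
def turn : H → H := t.pair ∘ G.mate

theorem turn_injective : Function.Injective t.turn :=
  t.pair_pair.injective.comp G.mate_involutive.injective

variable [Finite H]

theorem mem_periodicPts_turn (h : H) : h ∈ Function.periodicPts t.turn :=
  t.turn_injective.mem_periodicPts h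

/-- The directed circuit that starts along a half-edge. -/
noncomputable def dirWalk (h : H) : G.DirClosedWalk :=
  ⟨Function.periodicOrbit t.turn h, by
    constructor
    · rw [Ne, Function.periodicOrbit_eq_nil_iff_not_periodic_pt, not_not]
      exact t.mem_periodicPts_turn h
    · rw [Function.periodicOrbit_chain]
      intro n _
      rw [Function.iterate_succ_apply']
      exact (t.inc_pair _).symm⟩

theorem dirWalk_turn (h : H) : t.dirWalk (t.turn h) = t.dirWalk h :=
  Subtype.ext (Function.periodicOrbit_apply_eq (t.mem_periodicPts_turn h))

theorem dirWalk_mate (h : H) : t.dirWalk (G.mate h) = (t.dirWalk h).reverse :=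
  Subtype.ext (periodicOrbit_reverse t.turn_injective G.mate_involutive
    (fun x => by simp [turn, G.mate_mate, t.pair_pair _]) h)

/-- The closed walk along a circuit. -/
noncomputable def circuitWalk : t.Circuit → G.ClosedWalk :=
  Quot.lift (fun h => (Quotient.mk _ (t.dirWalk h) : G.ClosedWalk)) (by
    have hm : ∀ x, (Quotient.mk _ (t.dirWalk (G.mate x)) : G.ClosedWalk) =
        Quotient.mk _ (t.dirWalk x) := fun x => by
      rw [t.dirWalk_mate]
      exact (Quotient.sound (Or.inr rfl)).symm
    rintro x y (rfl | rfl)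
    · exact (hm x).symm
    · rw [← hm x, ← t.dirWalk_turn (G.mate x)]
      simp only [turn, Function.comp_apply, G.mate_mate]
      rfl)

/-- The collection of circuits of a transition system. -/
noncomputable def circuits : Multiset G.ClosedWalk :=
  (@Finset.univ t.Circuit (Fintype.ofFinite _)).val.map t.circuitWalk

theorem card_circuits : Multiset.card t.circuits = Nat.card t.Circuit := by
  rw [circuits, Multiset.card_map]
  exact (@Nat.card_eq_fintype_card _ (Fintype.ofFinite _)).symm

variable {t}

theorem mem_circuits {W : G.ClosedWalk} : W ∈ t.circuits ↔ ∃ h, t.circuitWalk (t.circuit h) = W := by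
  simp only [circuits, Multiset.mem_map]
  constructor
  · rintro ⟨q, -, rfl⟩
    induction q using Quot.inductionOn with | h h => exact ⟨h, rfl⟩
  · rintro ⟨h, rfl⟩
    exact ⟨t.circuit h, @Finset.mem_univ _ (Fintype.ofFinite _) _, rfl⟩

theorem mem_edges_circuitWalk {h g : H} :
    G.edge g ∈ (t.circuitWalk (t.circuit h)).edges ↔ t.SameCircuit h g := by
  change G.edge g ∈ (t.dirWalk h).edges ↔ _
  rw [DirClosedWalk.mem_edges]
  simp only [dirWalk, Function.mem_periodicOrbit_iff (t.mem_periodicPts_turn h)]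
  constructor
  · rintro (⟨n, e⟩ | ⟨n, e⟩)
    · exact e ▸ linked_iterate n h
    · exact (e ▸ linked_iterate n h : t.SameCircuit h (G.mate g)).trans (Linked.left g).symm
  · intro hl
    obtain ⟨n, e | e⟩ := exists_iterate_of_linked G.mate_involutive t.pair_pair hl
    exacts [Or.inl ⟨n, e⟩, Or.inr ⟨n, e⟩]

theorem isCircuit_circuitWalk (q : t.Circuit) : (t.circuitWalk q).IsCircuit := by
  induction q using Quot.inductionOn with
  | h h =>
    change ((Function.periodicOrbit t.turn h).toMultiset.map G.edge).Nodup
    refine Multiset.Nodup.map_on ?_ (nodup_toMultiset.2 Function.nodup_periodicOrbit)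
    intro x hx y hy e
    rw [mem_toMultiset] at hx hy
    rcases (G.edge_eq_iff x y).1 e with rfl | rfl
    · rfl
    obtain ⟨n, hn⟩ := (Function.mem_periodicOrbit_iff (t.mem_periodicPts_turn h)).1 hx
    obtain ⟨m, hm⟩ := (Function.mem_periodicOrbit_iff (t.mem_periodicPts_turn h)).1 hy
    -- Some power of `turn` would map `x` to `mate x`.
    obtain ⟨k, hk, hk'⟩ := t.mem_periodicPts_turn h
    refine absurd ?_ (iterate_ne_apply G.mate_involutive t.pair_pair G.mate_ne t.pair_ne
      (m + (k * n - n)) x)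
    change t.turn^[_] x = _
    rw [← hm, ← hn, ← Function.iterate_add_apply, show m + (k * n - n) + n = m + k * n by
      have : n ≤ k * n := Nat.le_mul_of_pos_left n hk
      omega, Function.iterate_add_apply, (hk'.mul_const n).eq]

theorem circuitWalk_injective : Function.Injective t.circuitWalk := by
  intro p q e
  induction p using Quot.inductionOn with
  | h x =>
    induction q using Quot.inductionOn with
    | h y =>
      have h1 : G.edge y ∈ (t.circuitWalk (t.circuit y)).edges :=
        mem_edges_circuitWalk.2 (.refl y)
      have h2 : t.circuitWalk (t.circuit x) = t.circuitWalk (t.circuit y) := e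
      rw [← h2] at h1
      exact circuit_eq_iff.2 (mem_edges_circuitWalk.1 h1)

theorem nodup_circuits : t.circuits.Nodup :=
  Multiset.Nodup.map circuitWalk_injective (Finset.nodup _)

/-- A closed walk all of whose turns are turns of `t` is a circuit of `t`. -/
theorem mk_eq_circuitWalk {w : G.DirClosedWalk} (hn : w.1.Nodup)
    (hw : ∀ x y, Consecutive w.1 x y → y = t.turn x) {g : H} (hg : g ∈ w.1) :
    (Quotient.mk _ w : G.ClosedWalk) = t.circuitWalk (t.circuit g) :=
  congrArg _ (Subtype.ext (eq_periodicOrbit hn hw hg))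

theorem exists_eq_circuitWalk {w : G.DirClosedWalk} (hn : w.1.Nodup)
    (hw : ∀ x y, Consecutive w.1 x y → y = t.turn x) :
    ∃ g, (Quotient.mk _ w : G.ClosedWalk) = t.circuitWalk (t.circuit g) := by
  obtain ⟨g, hg⟩ := Multiset.exists_mem_of_ne_zero (mt Cycle.toMultiset_eq_nil.1 w.2.1)
  exact ⟨g, mk_eq_circuitWalk hn hw (mem_toMultiset.1 hg)⟩

end TransitionSystem

/-! ### Circuit decompositions as transition systems -/

namespace IsCircuitDecomposition

variable {C : Multiset G.ClosedWalk}

theorem exists_mem (hC : G.IsCircuitDecomposition C) (g : H) : ∃ W ∈ C, G.edge g ∈ W.edges := by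
  classical
  have h := hC.2 (G.edge g) ⟨g, rfl⟩
  have : G.edge g ∈ C.bind ClosedWalk.edges := by
    by_contra hn
    rw [Multiset.count_eq_zero_of_notMem (by convert hn)] at h
    exact absurd h (by norm_num)
  simpa using this

theorem false_of_cons_cons (hC : G.IsCircuitDecomposition C)
    {W W' : G.ClosedWalk} {s : Multiset G.ClosedWalk}
    (e : C = W ::ₘ W' ::ₘ s) {g : H} (h : G.edge g ∈ W.edges) (h' : G.edge g ∈ W'.edges) :
    False := by
  classical
  have h1 := hC.2 (G.edge g) ⟨g, rfl⟩
  rw [e, Multiset.cons_bind, Multiset.cons_bind, Multiset.count_add, Multiset.count_add] at h1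
  have h2 := Multiset.count_pos.2 h
  have h3 := Multiset.count_pos.2 h'
  have h4 : ∀ (i j : DecidableEq (Sym2 H)) (M : Multiset (Sym2 H)) (a : Sym2 H),
      @Multiset.count _ i a M = @Multiset.count _ j a M := fun i j M a => by congr!
  rw [h4 _ (Classical.decEq _)] at h2 h3
  simp only [h4 _ (Classical.decEq _)] at h1
  omega

theorem eq_of_edge_mem (hC : G.IsCircuitDecomposition C) {W W' : G.ClosedWalk}
    (hW : W ∈ C) (hW' : W' ∈ C) {g : H}
    (h : G.edge g ∈ W.edges) (h' : G.edge g ∈ W'.edges) : W = W' := by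
  by_contra hne
  obtain ⟨s, rfl⟩ := Multiset.exists_cons_of_mem hW
  obtain ⟨s', rfl⟩ := Multiset.exists_cons_of_mem
    ((Multiset.mem_cons.1 hW').resolve_left (Ne.symm hne))
  exact hC.false_of_cons_cons rfl h h'

theorem nodup (hC : G.IsCircuitDecomposition C) : C.Nodup := by
  rw [Multiset.nodup_iff_ne_cons_cons]
  intro W s e
  obtain ⟨g, hg⟩ := W.exists_edge
  exact hC.false_of_cons_cons e hg hg

/-- The pairing is well defined, since only one member of `C` contains a given edge, and it does so in
only one of the two directions. -/
theorem exists_transition [Finite H] (hC : G.IsCircuitDecomposition C) :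
    ∃ t : G.TransitionSystem, C = t.circuits := by
  let T : H → H → Prop := fun a b => ∃ w : G.DirClosedWalk, (Quotient.mk _ w : G.ClosedWalk) ∈ C ∧
    Consecutive w.1 (G.mate a) b
  have hnd : ∀ w : G.DirClosedWalk, (Quotient.mk _ w : G.ClosedWalk) ∈ C → w.edges.Nodup :=
    fun w hw => hC.1 _ hw
  have hrev : ∀ w : G.DirClosedWalk,
      (Quotient.mk _ w : G.ClosedWalk) = Quotient.mk _ w.reverse := fun w =>
    Quotient.sound (Or.inr rfl)
  have hex : ∀ a, ∃ b, T a b := by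
    intro a
    obtain ⟨W, hW, ha⟩ := hC.exists_mem a
    induction W using Quotient.inductionOn with
    | h w =>
      rcases DirClosedWalk.mem_edges.1 ha with h | h
      · obtain ⟨b, hb⟩ := exists_consecutive (DirClosedWalk.mem_reverse.2 h)
        exact ⟨b, w.reverse, hrev w ▸ hW, hb⟩
      · obtain ⟨b, hb⟩ := exists_consecutive h
        exact ⟨b, w, hW, hb⟩
  have huniq : ∀ a b b', T a b → T a b' → b = b' := by
    rintro a b b' ⟨w, hw, hb⟩ ⟨w', hw', hb'⟩
    have e := hC.eq_of_edge_mem hw hw' (g := a) (DirClosedWalk.mem_edges.2 (Or.inr hb.left_mem))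
      (DirClosedWalk.mem_edges.2 (Or.inr hb'.left_mem))
    rcases Quotient.exact e with rfl | rfl
    · exact hb.unique hb' (DirClosedWalk.nodup_of_edges (hnd _ hw))
    · refine absurd hb.left_mem (DirClosedWalk.mate_notMem (hnd _ hw) ?_)
      exact DirClosedWalk.mem_reverse.1 hb'.left_mem
  have hsymm : ∀ a b, T a b → T b a := by
    rintro a b ⟨w, hw, hb⟩
    refine ⟨w.reverse, hrev w ▸ hw, ?_⟩
    have := DirClosedWalk.consecutive_reverse hb
    rwa [G.mate_mate] at this
  choose p hp using hex
  let t : G.TransitionSystem :=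
    { pair := p
      pair_pair := fun a => huniq _ _ _ (hp (p a)) (hsymm _ _ (hp a))
      pair_ne := fun a e => by
        obtain ⟨w, hw, hb⟩ := hp a
        rw [e] at hb
        exact DirClosedWalk.mate_notMem (hnd _ hw) hb.right_mem hb.left_mem
      inc_pair := fun a => by
        obtain ⟨w, hw, hb⟩ := hp a
        have := hb.chain w.2.2
        rw [G.mate_mate] at this
        exact this.symm }
  have key : ∀ W ∈ C, ∃ g, W = t.circuitWalk (t.circuit g) := by
    intro W hW
    induction W using Quotient.inductionOn with
    | h w =>
      refine TransitionSystem.exists_eq_circuitWalk (DirClosedWalk.nodup_of_edges (hnd _ hW))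
        fun x y hxy => huniq _ _ _ ⟨w, hW, ?_⟩ (hp (G.mate x))
      rwa [G.mate_mate]
  refine ⟨t, (Multiset.Nodup.ext hC.nodup TransitionSystem.nodup_circuits).2 fun W => ?_⟩
  rw [TransitionSystem.mem_circuits]
  constructor
  · intro hW
    obtain ⟨g, rfl⟩ := key W hW
    exact ⟨g, rfl⟩
  · rintro ⟨h, rfl⟩
    obtain ⟨W, hW, he⟩ := hC.exists_mem h
    obtain ⟨g, rfl⟩ := key W hW
    rw [TransitionSystem.mem_edges_circuitWalk] at he
    rwa [← TransitionSystem.circuit_eq_iff.2 he]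

end IsCircuitDecomposition

end HalfEdgeGraph

/-! ### Embeddings from complementary transition systems -/

namespace HalfEdgeGraph

theorem periodicOrbit_of_semiconj {X Y : Type*} {f : Y → Y} {g : X → X} {ι : X → Y}
    (hι : Function.Injective ι) (h : ∀ x, f (ι x) = ι (g x)) (x : X) :
    Function.periodicOrbit f (ι x) = (Function.periodicOrbit g x).map ι := by
  have hit : ∀ n, f^[n] (ι x) = ι (g^[n] x) := fun n =>
    ((Function.Semiconj.iterate_right (fun x => (h x).symm : Function.Semiconj ι g f) n) x).symm
  have hmin : Function.minimalPeriod f (ι x) = Function.minimalPeriod g x := by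
    rw [Function.minimalPeriod_eq_minimalPeriod_iff]
    intro n
    simp only [Function.IsPeriodicPt, Function.IsFixedPt, hit, hι.eq_iff]
  rw [Function.periodicOrbit_def, Function.periodicOrbit_def, hmin, Cycle.map_coe, List.map_map]
  congr 1
  exact List.map_congr_left fun n _ => hit n

theorem exists_add_of_map_eq_add {X Y : Type*} {f : X → Y} {s : Multiset X} {A B : Multiset Y}
    (h : s.map f = A + B) : ∃ a b, s = a + b ∧ a.map f = A ∧ b.map f = B := by
  induction A using Multiset.induction_on generalizing s with
  | empty => exact ⟨0, s, by simp, by simp, by simpa using h⟩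
  | cons y A ih =>
    rw [Multiset.cons_add] at h
    obtain ⟨x, hx, rfl⟩ := Multiset.mem_map.1 (h ▸ Multiset.mem_cons_self y _ : y ∈ s.map f)
    obtain ⟨s, rfl⟩ := Multiset.exists_cons_of_mem hx
    rw [Multiset.map_cons, Multiset.cons_inj_right] at h
    obtain ⟨a, b, rfl, rfl, rfl⟩ := ih h
    exact ⟨x ::ₘ a, b, by rw [Multiset.cons_add], by simp, rfl⟩

variable {V H : Type*} {G : HalfEdgeGraph V H}

namespace Embedding

variable (Φ : G.Embedding)

/-- The face traced from a state. -/
def face (x : H × Bool) : Φ.Face := Quot.mk _ x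

theorem face_step (x : H × Bool) : Φ.face (Φ.step x) = Φ.face x :=
  (Quot.sound (r := fun x y => y = Φ.step x ∨ y = Φ.flip x) (Or.inl rfl)).symm

theorem face_flip (x : H × Bool) : Φ.face (Φ.flip x) = Φ.face x :=
  (Quot.sound (r := fun x y => y = Φ.step x ∨ y = Φ.flip x) (Or.inr rfl)).symm

theorem face_iterate (n : ℕ) (x : H × Bool) : Φ.face (Φ.step^[n] x) = Φ.face x := by
  induction n with
  | zero => rfl
  | succ n ih => rw [Function.iterate_succ_apply', face_step, ih]

end Embedding

/-- The embedding `Φ` has the circuits of `t` and those of `t'` as its facial walks: the pairs of `t`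
and `t'` are alternately the corners at each vertex, and `δ` marks the half-edges that are followed
in the rotation by a corner of `t`. The signatures are such that the faces traced from the states
`(h, !δ h)` use the corners of `t` only. -/
structure Compatible (Φ : G.Embedding) (t t' : G.TransitionSystem) (δ : H → Bool) : Prop where
  pair_left : ∀ h, δ (t.pair h) = !δ h
  pair_right : ∀ h, δ (t'.pair h) = !δ h
  rot : ∀ h, Φ.rot h = if δ h then t.pair h else t'.pair h
  twist : ∀ h, Φ.twist h = !xor (δ h) (δ (G.mate h))

/-- Complementary transition systems define an embedding. -/
theorem exists_compatible [Finite H] {t t' : G.TransitionSystem} (h : t.Complementary t') :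
    ∃ (Φ : G.Embedding) (δ : H → Bool), Compatible Φ t t' δ := by
  obtain ⟨δ, hδ⟩ := exists_alternating t.pair_pair t'.pair_pair t.pair_ne t'.pair_ne
  let ρ : Equiv.Perm H :=
    { toFun := fun h => if δ h then t.pair h else t'.pair h
      invFun := fun h => if δ h then t'.pair h else t.pair h
      left_inv := fun h => by cases e : δ h <;> simp [e, hδ, t.pair_pair h, t'.pair_pair h]
      right_inv := fun h => by cases e : δ h <;> simp [e, hδ, t.pair_pair h, t'.pair_pair h] }
  have hρ : ∀ h, ρ h = if δ h then t.pair h else t'.pair h := fun _ => rfl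
  have hρ' : ∀ h, ρ.symm h = if δ h then t'.pair h else t.pair h := fun _ => rfl
  have hs : ∀ h, ρ.SameCycle h (ρ.symm h) := fun h => by
    have := (Equiv.Perm.SameCycle.refl ρ (ρ.symm h))
    rwa [← Equiv.Perm.sameCycle_apply_left, Equiv.apply_symm_apply] at this
  have hs' : ∀ h, ρ.SameCycle h (ρ h) := fun h => Equiv.Perm.sameCycle_apply_right.2 (.refl _ _)
  refine ⟨⟨ρ, fun h => ?_, fun x y e => ?_, fun h => !xor (δ h) (δ (G.mate h)), fun h => ?_⟩, δ,
    fun h => (hδ h).1, fun h => (hδ h).2, fun h => rfl, fun h => rfl⟩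
  · rw [hρ]
    split_ifs
    exacts [t.inc_pair h, t'.inc_pair h]
  · refine (h x y e).of_closed t.pair_pair t'.pair_pair (fun z hz => hz.trans ?_)
      (fun z hz => hz.trans ?_) (Equiv.Perm.SameCycle.refl ρ x)
    · have h1 := hs z
      have h2 := hs' z
      rw [hρ] at h2
      rw [hρ'] at h1
      cases e : δ z <;> simp_all
    · have h1 := hs z
      have h2 := hs' z
      rw [hρ] at h2
      rw [hρ'] at h1
      cases e : δ z <;> simp_all
  · rw [G.mate_mate, Bool.xor_comm]

namespace Compatible

variable {Φ : G.Embedding} {t t' : G.TransitionSystem} {δ : H → Bool}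

theorem rot_symm (hΦ : Compatible Φ t t' δ) (h : H) :
    Φ.rot.symm h = if δ h then t'.pair h else t.pair h := by
  rw [Equiv.symm_apply_eq, hΦ.rot]
  cases e : δ h <;>
    simp [e, hΦ.pair_left, hΦ.pair_right, t.pair_pair h, t'.pair_pair h]

theorem step_left (hΦ : Compatible Φ t t' δ) (h : H) :
    Φ.step (h, !δ h) = (t.turn h, !δ (t.turn h)) := by
  simp only [Embedding.step, hΦ.twist, hΦ.rot, hΦ.rot_symm, TransitionSystem.turn,
    Function.comp_apply, hΦ.pair_left]
  cases δ h <;> cases δ (G.mate h) <;> simp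

theorem step_right (hΦ : Compatible Φ t t' δ) (h : H) :
    Φ.step (h, δ h) = (t'.turn h, δ (t'.turn h)) := by
  simp only [Embedding.step, hΦ.twist, hΦ.rot, hΦ.rot_symm, TransitionSystem.turn,
    Function.comp_apply, hΦ.pair_right]
  cases δ h <;> cases δ (G.mate h) <;> simp

theorem flip_left (hΦ : Compatible Φ t t' δ) (h : H) :
    Φ.flip (h, !δ h) = (G.mate h, !δ (G.mate h)) := by
  simp only [Embedding.flip, hΦ.twist]
  cases δ h <;> cases δ (G.mate h) <;> simp

theorem flip_right (hΦ : Compatible Φ t t' δ) (h : H) :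
    Φ.flip (h, δ h) = (G.mate h, δ (G.mate h)) := by
  simp only [Embedding.flip, hΦ.twist]
  cases δ h <;> cases δ (G.mate h) <;> simp

theorem complementary [Finite H] (hΦ : Compatible Φ t t' δ) : t.Complementary t' := by
  intro x y e
  obtain ⟨n, rfl⟩ := (Φ.sameCycle_rot x y e).exists_nat_pow_eq
  clear e
  induction n with
  | zero => exact .refl x
  | succ n ih =>
    refine ih.trans ?_
    rw [pow_succ', Equiv.Perm.mul_apply, hΦ.rot]
    split_ifs
    exacts [.left _, .right _]

theorem orientable_iff [Finite H] (hΦ : Compatible Φ t t' δ) : Φ.Orientable ↔ t.Coherent t' := by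
  constructor
  · rintro ⟨e, he⟩
    refine ⟨fun h => xor (δ h) (e (G.inc h)), fun h => ⟨?_, ?_, ?_⟩⟩
    · have := he h
      rw [hΦ.twist] at this
      change xor (δ (G.mate h)) (e (G.inc (G.mate h))) = !xor (δ h) (e (G.inc h))
      revert this
      cases δ h <;> cases δ (G.mate h) <;> cases e (G.inc h) <;> cases e (G.inc (G.mate h)) <;> simp
    · simp [hΦ.pair_left, t.inc_pair]
    · simp [hΦ.pair_right, t'.inc_pair]
  · rintro ⟨ε, hε⟩
    have hfac : Function.FactorsThrough (fun h => xor (ε h) (δ h)) G.inc := fun x y e =>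
      (hΦ.complementary x y e).apply_eq (f := fun h => xor (ε h) (δ h))
        (fun h => by simp [hε, hΦ.pair_left])
        (fun h => by simp [hε, hΦ.pair_right])
    refine ⟨Function.extend G.inc (fun h => xor (ε h) (δ h)) fun _ => false, fun h => ?_⟩
    rw [hfac.extend_apply, hfac.extend_apply, (hε h).1, hΦ.twist]
    cases ε h <;> cases δ h <;> cases δ (G.mate h) <;> rfl

variable [Finite H]

/-- The faces on the two sides of the edges are the circuits of the two transition systems. -/
noncomputable def faceEquiv (hΦ : Compatible Φ t t' δ) : t.Circuit ⊕ t'.Circuit ≃ Φ.Face where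
  toFun := Sum.elim
    (Quot.lift (fun h => Φ.face (h, !δ h)) (by
      have hm : ∀ x, Φ.face (G.mate x, !δ (G.mate x)) = Φ.face (x, !δ x) := fun x => by
        rw [← hΦ.flip_left, Φ.face_flip]
      rintro x y (rfl | rfl)
      · exact (hm x).symm
      · rw [← hm x, ← Φ.face_step, hΦ.step_left, TransitionSystem.turn, Function.comp_apply,
          G.mate_mate]))
    (Quot.lift (fun h => Φ.face (h, δ h)) (by
      have hm : ∀ x, Φ.face (G.mate x, δ (G.mate x)) = Φ.face (x, δ x) := fun x => by
        rw [← hΦ.flip_right, Φ.face_flip]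
      rintro x y (rfl | rfl)
      · exact (hm x).symm
      · rw [← hm x, ← Φ.face_step, hΦ.step_right, TransitionSystem.turn, Function.comp_apply,
          G.mate_mate]))
  invFun := Quot.lift
    (fun x => if x.2 = δ x.1 then Sum.inr (t'.circuit x.1) else Sum.inl (t.circuit x.1)) (by
      have key : ∀ x : H × Bool, x = (x.1, δ x.1) ∨ x = (x.1, !δ x.1) := by
        rintro ⟨h, b⟩
        cases b <;> cases δ h <;> simp
      have h1 : ∀ (h : H), t.circuit (t.turn h) = t.circuit h := fun h => by
        rw [TransitionSystem.turn, Function.comp_apply, TransitionSystem.circuit_pair,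
          TransitionSystem.circuit_mate]
      have h2 : ∀ (h : H), t'.circuit (t'.turn h) = t'.circuit h := fun h => by
        rw [TransitionSystem.turn, Function.comp_apply, TransitionSystem.circuit_pair,
          TransitionSystem.circuit_mate]
      rintro x y (rfl | rfl) <;> rcases key x with e | e <;> rw [e]
      · rw [hΦ.step_right]
        simp [h2]
      · rw [hΦ.step_left]
        simp [h1]
      · rw [hΦ.flip_right]
        simp [TransitionSystem.circuit_mate]
      · rw [hΦ.flip_left]
        simp [TransitionSystem.circuit_mate])
  left_inv := by
    rintro (q | q)
    · induction q using Quot.inductionOn with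
      | h h => exact if_neg (by simp : ¬ (!δ h) = δ h)
    · induction q using Quot.inductionOn with
      | h h => exact if_pos (rfl : δ h = δ h)
  right_inv := by
    intro F
    induction F using Quot.inductionOn with
    | h x =>
      obtain ⟨h, b⟩ := x
      change Sum.elim _ _ (if b = δ h then Sum.inr (t'.circuit h) else Sum.inl (t.circuit h)) = _
      split_ifs with e
      · subst e
        rfl
      · obtain rfl := Bool.eq_not_of_ne e
        rfl

theorem faceWalk_left (hΦ : Compatible Φ t t' δ) (h : H) :
    Φ.faceWalk (Φ.face (h, !δ h)) = t.circuitWalk (t.circuit h) := by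
  refine congrArg (Quotient.mk _) (Subtype.ext ?_)
  change (Function.periodicOrbit Φ.step (h, !δ h)).map Prod.fst = Function.periodicOrbit t.turn h
  rw [periodicOrbit_of_semiconj (ι := fun h => (h, !δ h)) (g := t.turn)
    (fun x y e => congrArg Prod.fst e) hΦ.step_left]
  generalize Function.periodicOrbit t.turn h = c
  induction c using Quotient.inductionOn with
  | h l =>
    change (((l.map _).map _ : List H) : Cycle H) = (l : Cycle H)
    simp [Function.comp_def]

theorem faceWalk_right (hΦ : Compatible Φ t t' δ) (h : H) :
    Φ.faceWalk (Φ.face (h, δ h)) = t'.circuitWalk (t'.circuit h) := by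
  refine congrArg (Quotient.mk _) (Subtype.ext ?_)
  change (Function.periodicOrbit Φ.step (h, δ h)).map Prod.fst = Function.periodicOrbit t'.turn h
  rw [periodicOrbit_of_semiconj (ι := fun h => (h, δ h)) (g := t'.turn)
    (fun x y e => congrArg Prod.fst e) hΦ.step_right]
  generalize Function.periodicOrbit t'.turn h = c
  induction c using Quotient.inductionOn with
  | h l =>
    change (((l.map _).map _ : List H) : Cycle H) = (l : Cycle H)
    simp [Function.comp_def]

theorem isRelative (hΦ : Compatible Φ t t' δ) : Φ.IsRelative t.circuits t'.circuits := by
  classical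
  let _ := Fintype.ofFinite Φ.Face
  let _ := Fintype.ofFinite t.Circuit
  let _ := Fintype.ofFinite t'.Circuit
  have h1 : (Finset.univ : Finset Φ.Face) = Finset.univ.map hΦ.faceEquiv.toEmbedding := by simp
  change (Finset.univ : Finset Φ.Face).val.map Φ.faceWalk =
    (Finset.univ : Finset t.Circuit).val.map _ + (Finset.univ : Finset t'.Circuit).val.map _
  rw [h1, Finset.map_val, Multiset.map_map, ← Finset.univ_disjSum_univ, Finset.val_disjSum,
    Multiset.disjSum, Multiset.map_add, Multiset.map_map, Multiset.map_map]
  congr 1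
  · refine Multiset.map_congr rfl fun q _ => ?_
    induction q using Quot.inductionOn with | h h => exact hΦ.faceWalk_left h
  · refine Multiset.map_congr rfl fun q _ => ?_
    induction q using Quot.inductionOn with | h h => exact hΦ.faceWalk_right h

end Compatible

/-! ### Every relative embedding arises in this way -/

namespace Embedding

variable [Finite H] (Φ : G.Embedding)

theorem edges_tracedWalk (x : H × Bool) : (Φ.tracedWalk x).edges =
    (Function.periodicOrbit Φ.step x).toMultiset.map fun y => G.edge y.1 := by
  change (((Function.periodicOrbit Φ.step x).map Prod.fst).toMultiset).map G.edge = _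
  generalize Function.periodicOrbit Φ.step x = c
  induction c using Quotient.inductionOn with
  | h l =>
    change (((l.map Prod.fst).map G.edge : List (Sym2 H)) : Multiset (Sym2 H)) =
      ((l.map fun y => G.edge y.1 : List (Sym2 H)) : Multiset (Sym2 H))
    simp [Function.comp_def]

theorem mem_edges_tracedWalk (x : H × Bool) (e : Sym2 H) :
    e ∈ (Φ.tracedWalk x).edges ↔ ∃ n, G.edge (Φ.step^[n] x).1 = e := by
  rw [edges_tracedWalk, Multiset.mem_map]
  simp only [mem_toMultiset, Function.mem_periodicOrbit_iff (Φ.mem_periodicPts x)]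
  constructor
  · rintro ⟨_, ⟨n, rfl⟩, h⟩
    exact ⟨n, h⟩
  · rintro ⟨n, h⟩
    exact ⟨_, ⟨n, rfl⟩, h⟩

theorem exists_iterate_of_face_eq {x y : H × Bool} (h : Φ.face x = Φ.face y) :
    ∃ n, Φ.step^[n] x = y ∨ Φ.step^[n] x = Φ.flip y := by
  have hcomp : (Φ.step ∘ Φ.flip) ∘ Φ.flip = Φ.step := by
    funext z
    simp [Φ.flip_flip]
  have hinv : Function.Involutive (Φ.step ∘ Φ.flip) := fun z => by
    simp [Φ.step_flip_step, Φ.flip_flip]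
  have hl : Linked Φ.flip (Φ.step ∘ Φ.flip) x y := by
    have := Quot.eqvGen_exact h
    clear h
    induction this with
    | rel x y h =>
      rcases h with rfl | rfl
      · have := (Linked.left x).trans (Linked.right (α := Φ.flip) (β := Φ.step ∘ Φ.flip) (Φ.flip x))
        simpa [Φ.flip_flip] using this
      · exact .left x
    | refl => exact .refl _
    | symm _ _ _ ih => exact ih.symm
    | trans _ _ _ _ _ ih ih' => exact ih.trans ih'
  have := exists_iterate_of_linked Φ.flip_flip hinv hl
  rwa [hcomp] at this

/-- The faces bounded by the members of `C` cover exactly one side of every edge, and so do the outer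
faces; hence the corners of these two kinds of faces alternate around every vertex. -/
theorem exists_compatible_of_isRelative {Φ : G.Embedding} {C O : Multiset G.ClosedWalk}
    (hC : G.IsCircuitDecomposition C) (hΦ : Φ.IsRelative C O) :
    ∃ (t t' : G.TransitionSystem) (δ : H → Bool), Compatible Φ t t' δ ∧ C = t.circuits ∧
      O = t'.circuits := by
  classical
  let _ := Fintype.ofFinite Φ.Face
  obtain ⟨s, s', hs, rfl, -⟩ := exists_add_of_map_eq_add
    (show (Finset.univ : Finset Φ.Face).val.map Φ.faceWalk = C + O from hΦ)
  let P : H × Bool → Prop := fun x => Φ.face x ∈ s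
  have hPs : ∀ x, P (Φ.step x) ↔ P x := fun x => by simp only [P, face_step]
  have hPf : ∀ x, P (Φ.flip x) ↔ P x := fun x => by simp only [P, face_flip]
  have hself : ∀ x, G.edge x.1 ∈ (Φ.faceWalk (Φ.face x)).edges := fun x =>
    (Φ.mem_edges_tracedWalk x _).2 ⟨0, rfl⟩
  -- Each edge is used by a member of `C` ...
  have hex : ∀ h, ∃ b, P (h, b) := by
    intro h
    obtain ⟨W, hW, he⟩ := hC.exists_mem h
    obtain ⟨F, hF, rfl⟩ := Multiset.mem_map.1 hW
    induction F using Quot.inductionOn with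
    | h x =>
      obtain ⟨n, hn⟩ := (Φ.mem_edges_tracedWalk x _).1 he
      have hP : P (Φ.step^[n] x) := by
        simp only [P, face_iterate]
        exact hF
      rcases (G.edge_eq_iff _ _).1 hn.symm with e | e
      · exact ⟨_, by simpa [← e] using hP⟩
      · refine ⟨_, (?_ : P (h, (Φ.flip (Φ.step^[n] x)).2))⟩
        have h1 : (h, (Φ.flip (Φ.step^[n] x)).2) = Φ.flip (Φ.step^[n] x) :=
          Prod.ext (by simp [flip, e, G.mate_mate]) rfl
        rw [h1, hPf]
        exact hP
  -- ... but not on both sides, neither by two members nor twice by the same one.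
  have hnot : ∀ h, P (h, true) → P (h, false) → False := by
    intro h h1 h2
    by_cases e : Φ.face (h, true) = Φ.face (h, false)
    · have hnd : (Φ.tracedWalk (h, true)).edges.Nodup := hC.1 _ (Multiset.mem_map_of_mem _ h1)
      rw [edges_tracedWalk] at hnd
      have hm : ∀ n, Φ.step^[n] (h, true) ∈ (Function.periodicOrbit Φ.step (h, true)).toMultiset :=
        fun n => mem_toMultiset.2 (Function.iterate_mem_periodicOrbit (Φ.mem_periodicPts _) n)
      obtain ⟨n, hn | hn⟩ := Φ.exists_iterate_of_face_eq e
      · have := Multiset.inj_on_of_nodup_map hnd _ (hm n) _ (hm 0) (by simp [hn])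
        rw [hn] at this
        simp at this
      · have := Multiset.inj_on_of_nodup_map hnd _ (hm n) _ (hm 0) (by simp [hn, flip, G.edge_mate])
        rw [hn] at this
        exact G.mate_ne h (congrArg Prod.fst this)
    · obtain ⟨r, rfl⟩ := Multiset.exists_cons_of_mem h1
      obtain ⟨r, rfl⟩ := Multiset.exists_cons_of_mem
        ((Multiset.mem_cons.1 h2).resolve_left (Ne.symm e))
      exact hC.false_of_cons_cons (g := h) (by rw [Multiset.map_cons, Multiset.map_cons])
        (hself _) (hself _)
  let δ : H → Bool := fun h => decide (P (h, false))
  have hP : ∀ h b, P (h, b) ↔ b = !δ h := by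
    intro h b
    obtain ⟨c, hc⟩ := hex h
    have := hnot h
    by_cases h1 : P (h, false) <;> cases b <;> cases c <;> simp_all [δ]
  have htw : ∀ h, Φ.twist h = !xor (δ h) (δ (G.mate h)) := by
    intro h
    have h1 := (hPf (h, !δ h)).2 ((hP h _).2 rfl)
    have h2 := (hP (G.mate h) _).1 h1
    revert h2
    simp only
    cases δ h <;> cases δ (G.mate h) <;> cases Φ.twist h <;> simp
  have hstep : ∀ h b, (if xor b (!xor (δ (G.mate h)) (δ h)) then P (Φ.rot h, true)
      else P (Φ.rot.symm h, false)) ↔ b = !δ (G.mate h) := by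
    intro h b
    rw [← hP (G.mate h), ← hPs (G.mate h, b)]
    simp only [step, htw, G.mate_mate]
    split_ifs <;> rfl
  have hp : ∀ h, δ (if δ h then Φ.rot h else Φ.rot.symm h) = !δ h := by
    intro h
    have h1 := (hstep h (!δ (G.mate h))).2 rfl
    simp only [hP] at h1
    cases e : δ h <;> cases e' : δ (G.mate h) <;> simp_all
  have hp' : ∀ h, δ (if δ h then Φ.rot.symm h else Φ.rot h) = !δ h := by
    intro h
    have h1 := mt (hstep h (δ (G.mate h))).1 (by simp)
    simp only [hP] at h1
    cases e : δ h <;> cases e' : δ (G.mate h) <;> simp_all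
  have hinc : ∀ h, G.inc (Φ.rot.symm h) = G.inc h := fun h => by
    rw [← Φ.inc_rot (Φ.rot.symm h), Equiv.apply_symm_apply]
  let t : G.TransitionSystem :=
    { pair := fun h => if δ h then Φ.rot h else Φ.rot.symm h
      pair_pair := fun h => by
        have := hp h
        cases e : δ h <;> simp_all
      pair_ne := fun h e => by
        have := hp h
        rw [e] at this
        simp at this
      inc_pair := fun h => by
        split_ifs
        exacts [Φ.inc_rot h, hinc h] }
  let t' : G.TransitionSystem :=
    { pair := fun h => if δ h then Φ.rot.symm h else Φ.rot h
      pair_pair := fun h => by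
        have := hp' h
        cases e : δ h <;> simp_all
      pair_ne := fun h e => by
        have := hp' h
        rw [e] at this
        simp at this
      inc_pair := fun h => by
        split_ifs
        exacts [hinc h, Φ.inc_rot h] }
  have hcomp : Compatible Φ t t' δ := ⟨hp, hp', fun h => by
    simp only [t, t']
    split_ifs <;> rfl, htw⟩
  have hCt : s.map Φ.faceWalk = t.circuits := by
    refine (Multiset.Nodup.ext hC.nodup TransitionSystem.nodup_circuits).2 fun W => ?_
    rw [TransitionSystem.mem_circuits, Multiset.mem_map]
    constructor
    · rintro ⟨F, hF, rfl⟩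
      induction F using Quot.inductionOn with
      | h x =>
        obtain ⟨h, b⟩ := x
        obtain rfl := (hP h b).1 hF
        exact ⟨h, (hcomp.faceWalk_left h).symm⟩
    · rintro ⟨h, rfl⟩
      exact ⟨_, (hP h _).2 rfl, hcomp.faceWalk_left h⟩
  refine ⟨t, t', δ, hcomp, hCt, ?_⟩
  have h1 : Φ.facialWalks = s.map Φ.faceWalk + O := hΦ
  have h2 : Φ.facialWalks = _ := hcomp.isRelative
  rw [h2, hCt] at h1
  exact (add_left_cancel h1).symm

end Embedding

end HalfEdgeGraph

/-! ### Realizability of circuit decompositions -/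

namespace HalfEdgeGraph

variable {V H : Type*} {G : HalfEdgeGraph V H}

namespace TransitionSystem

variable {t t' : G.TransitionSystem}

theorem visitsOnce_of_isCycle [Finite H] (h : ∀ W ∈ t.circuits, W.IsCycle) : t.VisitsOnce := by
  intro a k hl e
  have h2 := (h _ (mem_circuits.2 ⟨a, rfl⟩)).2 a (mem_edges_circuitWalk.2 (.refl a))
  simp only [mem_edges_circuitWalk] at h2
  exact eq_or_eq_of_ncard_eq_two h2 ⟨.refl a, rfl⟩ ⟨.right a, t.inc_pair a⟩ (t.pair_ne a).symm
    ⟨hl, e⟩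

/-- If the incidence graph is acyclic, the circuits of `t` are precisely the cycles of the graph. -/
theorem TreeLike.mem_circuits_iff [Finite H] (ht : t.TreeLike) (W : G.ClosedWalk) :
    W ∈ t.circuits ↔ W.IsCycle := by
  constructor
  · rw [mem_circuits]
    rintro ⟨a, rfl⟩
    refine ⟨isCircuit_circuitWalk _, fun g hg => ?_⟩
    rw [mem_edges_circuitWalk] at hg
    simp only [mem_edges_circuitWalk]
    exact ht.visitsOnce.ncard_eq_two hg
  · rintro ⟨hc, h2⟩
    induction W using Quotient.inductionOn with
    | h w =>
      have hnd : w.edges.Nodup := hc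
      have hturn : ∀ x y, Consecutive w.1 x y → y = t.turn x := by
        intro x y hxy
        have hx := hxy.left_mem
        have hy := hxy.right_mem
        refine ht.eq_pair (U := {h | G.edge h ∈ w.edges}) (a := G.mate x) (b := y)
          (fun h hh => ?_) h2 ?_ (DirClosedWalk.mem_edges.2 (Or.inl hy)) ?_ ?_
        · change G.edge (G.mate h) ∈ w.edges
          rwa [G.edge_mate]
        · exact DirClosedWalk.mem_edges.2 (Or.inr (by rwa [G.mate_mate]))
        · rintro rfl
          exact DirClosedWalk.mate_notMem hnd hx hy
        · exact (hxy.chain w.2.2).symm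
      obtain ⟨g, hg⟩ := exists_eq_circuitWalk (DirClosedWalk.nodup_of_edges hnd) hturn
      rw [hg]
      exact mem_circuits.2 ⟨g, rfl⟩

/-- The incidence graph of the vertices and the members of a circuit decomposition is acyclic if and
only if the graph is a tree of cycles, decomposed into its cycles. -/
theorem treeLike_iff [Finite V] [Finite H] [Nonempty H] (hG : G.Connected) :
    t.TreeLike ↔ G.IsTreeOfCycles ∧ ∀ W : G.ClosedWalk, W ∈ t.circuits ↔ W.IsCycle :=
  ⟨fun ht => ⟨ht.isTreeOfCycles hG, ht.mem_circuits_iff⟩, fun h =>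
    treeLike_of_isTreeOfCycles h.1 (visitsOnce_of_isCycle fun W hW => (h.2 W).1 hW)⟩

theorem card_circuits_eq_one_iff [Finite H] [Nonempty H] :
    Multiset.card t.circuits = 1 ↔ ∀ x y, t.SameCircuit x y := by
  rw [card_circuits, Nat.card_eq_one_iff_unique]
  constructor
  · rintro ⟨h, -⟩ x y
    exact circuit_eq_iff.1 (Subsingleton.elim _ _)
  · intro h
    refine ⟨⟨fun p q => ?_⟩, ⟨t.circuit (Classical.arbitrary H)⟩⟩
    induction p using Quot.inductionOn with
    | h x => induction q using Quot.inductionOn with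
      | h y => exact circuit_eq_iff.2 (h x y)

/-- If there is only one circuit, it is an euler circuit. -/
theorem isEulerCircuit [Finite H] [Nonempty H] (hG : G.Connected)
    (h1 : Multiset.card t.circuits = 1) {W : G.ClosedWalk} (hW : W ∈ t.circuits) :
    W.IsEulerCircuit := by
  obtain ⟨a, rfl⟩ := mem_circuits.1 hW
  have hs := card_circuits_eq_one_iff.1 h1
  refine ⟨isCircuit_circuitWalk _, ?_, fun v => ?_⟩
  · rintro _ ⟨g, rfl⟩
    exact mem_edges_circuitWalk.2 (hs a g)
  · obtain ⟨h, -, e⟩ := Subgraph.Connected.exists_half hG Set.univ_nonempty (Set.mem_univ v)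
    exact ⟨h, e, mem_edges_circuitWalk.2 (hs a h)⟩

end TransitionSystem

theorem Embedding.card_face [Finite H] {Φ : G.Embedding} {C O : Multiset G.ClosedWalk}
    (h : Φ.IsRelative C O) : Nat.card Φ.Face = Multiset.card C + Multiset.card O := by
  rw [← Multiset.card_add, ← h, facialWalks, Multiset.card_map]
  exact @Nat.card_eq_fintype_card _ (Fintype.ofFinite _)

end HalfEdgeGraph

theorem mainTheorem5 {V H : Type*} [Finite V] [Finite H] (G : HalfEdgeGraph V H)
    (hG : G.IsEulerian) (hnt : G.IsNontrivial)
    (C : Multiset G.ClosedWalk) (hC : G.IsCircuitDecomposition C) :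
    ((G.IsTreeOfCycles ∧ ∀ W : G.ClosedWalk, W ∈ C ↔ W.IsCycle) →
      (∃ (Φ : G.Embedding) (O : Multiset G.ClosedWalk), Φ.IsRelative C O) ∧
      ∀ (Φ : G.Embedding) (O : Multiset G.ClosedWalk), Φ.IsRelative C O →
        Φ.IsPlanar ∧ Multiset.card O = 1) ∧
    (¬ (G.IsTreeOfCycles ∧ ∀ W : G.ClosedWalk, W ∈ C ↔ W.IsCycle) →
      G.OrientablyRealizable C ∧ G.NonorientablyRealizable C ∧
      ∃ (Φ : G.Embedding) (O : Multiset G.ClosedWalk),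
        Φ.IsRelative C O ∧ ¬ Φ.Orientable ∧ Multiset.card O = 1) ∧
    ∀ (Φ : G.Embedding) (O : Multiset G.ClosedWalk), Φ.IsRelative C O → Multiset.card O = 1 →
      (∀ W ∈ O, W.IsEulerCircuit) ∧
      (∀ (Ψ : G.Embedding) (P : Multiset G.ClosedWalk), Ψ.IsRelative C P →
        Ψ.eulerGenus ≤ Φ.eulerGenus) ∧
      (Φ.Orientable → ∀ (Ψ : G.Embedding) (P : Multiset G.ClosedWalk), Ψ.IsRelative C P →
        Ψ.Orientable → Ψ.genus ≤ Φ.genus) ∧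
      (¬ Φ.Orientable → ∀ (Ψ : G.Embedding) (P : Multiset G.ClosedWalk), Ψ.IsRelative C P →
        ¬ Ψ.Orientable → Ψ.genus ≤ Φ.genus) := by
  obtain ⟨_, g₀, -⟩ := hnt
  have : Nonempty H := ⟨g₀⟩
  have hconn := hG.1
  obtain ⟨t, rfl⟩ := hC.exists_transition
  have hor : G.OrientablyRealizable t.circuits := by
    obtain ⟨t', hcoh, hcompl⟩ := t.exists_complementary_coherent
    obtain ⟨Φ, δ, hΦ⟩ := HalfEdgeGraph.exists_compatible hcompl
    exact ⟨Φ, t'.circuits, hΦ.isRelative, hΦ.orientable_iff.2 hcoh⟩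
  refine ⟨fun htree => ⟨?_, fun Φ O hΦ => ?_⟩, fun hn => ?_, fun Φ O hΦ hO => ?_⟩
  · obtain ⟨Φ, O, h, -⟩ := hor
    exact ⟨Φ, O, h⟩
  · have hcard := HalfEdgeGraph.Embedding.card_face hΦ
    obtain ⟨u, u', δ, hcomp, hu, rfl⟩ :=
      HalfEdgeGraph.Embedding.exists_compatible_of_isRelative hC hΦ
    rw [hu] at htree hcard
    have htl : u.TreeLike := (HalfEdgeGraph.TransitionSystem.treeLike_iff hconn).2 htree
    have hone : Multiset.card u'.circuits = 1 :=
      HalfEdgeGraph.TransitionSystem.card_circuits_eq_one_iff.2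
        (htl.sameCircuit hconn hcomp.complementary)
    refine ⟨⟨hcomp.orientable_iff.2 (htl.coherent u'), ?_⟩, hone⟩
    have h1 := htl.card_add_card hconn
    rw [hone, HalfEdgeGraph.TransitionSystem.card_circuits] at hcard
    rw [HalfEdgeGraph.Embedding.eulerGenus, hcard]
    push_cast
    omega
  · have hnt : ¬ t.TreeLike := fun h => hn ((HalfEdgeGraph.TransitionSystem.treeLike_iff hconn).1 h)
    obtain ⟨t', hcoh, hcompl, hone⟩ :=
      HalfEdgeGraph.TransitionSystem.exists_complementary_not_coherent hconn hnt
    obtain ⟨Φ, δ, hΦ⟩ := HalfEdgeGraph.exists_compatible hcompl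
    have hno : ¬ Φ.Orientable := fun h => hcoh (hΦ.orientable_iff.1 h)
    exact ⟨hor, ⟨Φ, t'.circuits, hΦ.isRelative, hno⟩, Φ, t'.circuits, hΦ.isRelative, hno,
      HalfEdgeGraph.TransitionSystem.card_circuits_eq_one_iff.2 hone⟩
  · have hgenus : ∀ (Ψ : G.Embedding) (P : Multiset G.ClosedWalk), Ψ.IsRelative t.circuits P →
        Ψ.eulerGenus ≤ Φ.eulerGenus := by
      intro Ψ P hΨ
      obtain ⟨u, u', δ, -, -, rfl⟩ :=
        HalfEdgeGraph.Embedding.exists_compatible_of_isRelative hC hΨ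
      have h1 : 0 < Multiset.card u'.circuits :=
        Multiset.card_pos_iff_exists_mem.2
          ⟨_, HalfEdgeGraph.TransitionSystem.mem_circuits.2 ⟨g₀, rfl⟩⟩
      have h2 := HalfEdgeGraph.Embedding.card_face hΦ
      have h3 := HalfEdgeGraph.Embedding.card_face hΨ
      rw [HalfEdgeGraph.Embedding.eulerGenus, HalfEdgeGraph.Embedding.eulerGenus]
      omega
    refine ⟨?_, hgenus, fun ho Ψ P hΨ ho' => ?_, fun ho Ψ P hΨ ho' => ?_⟩
    · obtain ⟨u, u', δ, -, -, rfl⟩ :=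
        HalfEdgeGraph.Embedding.exists_compatible_of_isRelative hC hΦ
      exact fun W hW => HalfEdgeGraph.TransitionSystem.isEulerCircuit hconn hO hW
    · rw [HalfEdgeGraph.Embedding.genus, HalfEdgeGraph.Embedding.genus, if_pos ho, if_pos ho']
      have : (Ψ.eulerGenus : ℚ) ≤ Φ.eulerGenus := by exact_mod_cast hgenus Ψ P hΨ
      linarith
    · rw [HalfEdgeGraph.Embedding.genus, HalfEdgeGraph.Embedding.genus, if_neg ho, if_neg ho']
      exact_mod_cast hgenus Ψ P hΨ
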